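/- Let $F$ be Thompson's group, realized as the group (under composition) of all strictly increasing continuous piecewise-linear maps of $[0,1]$ onto itself which are differentiable except at finitely many dyadic rationals and whose slopes are integer powers of $2$. Let $x_0,x_1\in F$ be the standard generators: $$x_n(t)=\begin{cases} t, & t\in[0,1-2^{-n}],\\ \tfrac12 t+\tfrac{2^n-1}{2^{n+1}}, & t\in[1-2^{-n},1-2^{-n-1}],\\ t-2^{-n-2}, & t\in[1-2^{-n-1},1-2^{-n-2}],\\ 2t-1, & t\in[1-2^{-n-2},1].\end{cases}$$ For $f\in F$ put $\operatorname{supp}(f)=\{t\in[0,1] : f(t)\neq t\}$, and let $$H_1=\{f\in F : 1\notin\overline{\operatorname{supp}(f)}\},$$ a subgroup of $F$. Let $F*_{H_1}=\langle F,g \mid ghg^{-1}=h,\ h\in H_1\rangle$ be the centralized HNN-extension of $F$ over $H_1$ with stable letter $g$. A group marked by $n$ elements is a group $G$ together with an $n$-tuple of elements generating $G$. Let $\mathcal G_n$ be the space of groups marked by $n$ elements, up to isomorphism respecting the markings, with the metric in which two marked groups are at distance at most $e^{-R}$ ($R\in\mathbb N$) if and only if they have exactly the same relations of length at most $R$. Theorem.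 There is a sequence $(g_n)_{n\in\mathbb N}$ of elements of $F$ such that the triples $(g_n,x_0,x_1)$ generate $F$, the triple $(g,x_0,x_1)$ generates $F*_{H_1}$, and the marked groups $(F,(g_n,x_0,x_1))$ converge in $\mathcal G_3$ to $(F*_{H_1},(g,x_0,x_1))$. Moreover, the subgroup $H_1$ is not finitely generated, so that a limit of groups marked by three elements, each isomorphic to $F$, can be an HNN-extension of $F$ over an infinitely generated subgroup. -/

import Mathlib

open Set Filter Topology

/-! ### Thompson's group `F` as a group of piecewise linear homeomorphisms of `[0,1]` -/

/-- Dyadic rational numbers, i.e. the elements of `ℤ[1/2]`. -/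
def IsDyadic (x : ℝ) : Prop := ∃ (m : ℤ) (n : ℕ), x = m / 2 ^ n

theorem isDyadic_zero : IsDyadic 0 := ⟨0, 0, by simp⟩

theorem isDyadic_one : IsDyadic 1 := ⟨1, 0, by simp⟩

theorem IsDyadic.add {x y : ℝ} (hx : IsDyadic x) (hy : IsDyadic y) : IsDyadic (x + y) := by
  obtain ⟨m, n, rfl⟩ := hx
  obtain ⟨m', n', rfl⟩ := hy
  refine ⟨m * 2 ^ n' + m' * 2 ^ n, n + n', ?_⟩
  push_cast
  rw [pow_add]
  field_simp

theorem IsDyadic.neg {x : ℝ} (hx : IsDyadic x) : IsDyadic (-x) := by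
  obtain ⟨m, n, rfl⟩ := hx
  exact ⟨-m, n, by push_cast; ring⟩

theorem IsDyadic.sub {x y : ℝ} (hx : IsDyadic x) (hy : IsDyadic y) : IsDyadic (x - y) := by
  rw [sub_eq_add_neg]
  exact hx.add hy.neg

theorem IsDyadic.zpow_mul {x : ℝ} (hx : IsDyadic x) (k : ℤ) : IsDyadic ((2 : ℝ) ^ k * x) := by
  obtain ⟨m, n, rfl⟩ := hx
  obtain ⟨j, rfl | rfl⟩ := k.eq_nat_or_neg
  · refine ⟨2 ^ j * m, n, ?_⟩
    push_cast
    rw [zpow_natCast]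
    ring
  · refine ⟨m, n + j, ?_⟩
    rw [zpow_neg, zpow_natCast, pow_add]
    field_simp

/-- An increasing bijection `f` of `[0,1]` onto itself is piecewise linear, with all breakpoints in
a finite set `S` of dyadic rationals and with all slopes integer powers of `2`: on every interval
`[a,b]` whose interior does not meet `S` it has the form `t ↦ 2 ^ k * t + c`. -/
def IsThompson (f : unitInterval ≃o unitInterval) : Prop :=
  ∃ S : Finset ℝ, (∀ s ∈ S, IsDyadic s) ∧
    ∀ a b : unitInterval, a < b → (∀ s ∈ S, s ∉ Ioo (a : ℝ) (b : ℝ)) →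
      ∃ (k : ℤ) (c : ℝ), ∀ t ∈ Icc a b, (f t : ℝ) = 2 ^ k * (t : ℝ) + c

theorem IsThompson.isDyadic_iff {f : unitInterval ≃o unitInterval} (hf : IsThompson f)
    (t : unitInterval) : IsDyadic (t : ℝ) ↔ IsDyadic (f t : ℝ) := by
  obtain ⟨S, hS, h⟩ := hf
  have key : ∀ p t : unitInterval, p < t → (∀ s ∈ S, s ∉ Ioo (p : ℝ) (t : ℝ)) →
      IsDyadic (p : ℝ) → IsDyadic (f p : ℝ) → (IsDyadic (t : ℝ) ↔ IsDyadic (f t : ℝ)) := by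
    intro p t hpt hs hp hfp
    obtain ⟨k, c, hk⟩ := h p t hpt hs
    have h1 := hk p ⟨le_rfl, hpt.le⟩
    have h2 := hk t ⟨hpt.le, le_rfl⟩
    have h3 : (f t : ℝ) = (f p : ℝ) + 2 ^ k * ((t : ℝ) - p) := by rw [h1, h2]; ring
    constructor
    · intro ht
      rw [h3]
      exact hfp.add ((ht.sub hp).zpow_mul k)
    · intro ht
      have h4 : (t : ℝ) = (p : ℝ) + 2 ^ (-k) * ((f t : ℝ) - f p) := by
        rw [h3, zpow_neg]
        field_simp
        ring
      rw [h4]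
      exact hp.add ((ht.sub hfp).zpow_mul (-k))
  have h0 : f 0 = 0 := f.map_bot
  have main : ∀ (n : ℕ) (t : unitInterval), (S.filter (· < (t : ℝ))).card = n →
      (IsDyadic (t : ℝ) ↔ IsDyadic (f t : ℝ)) := by
    intro n
    induction n using Nat.strong_induction_on with
    | _ n ih =>
      intro t ht
      rcases eq_or_lt_of_le (unitInterval.nonneg' (t := t)) with h00 | hpos
      · rw [← h00, h0]
      by_cases hne : (S.filter (fun s => s ∈ Ioo (0 : ℝ) (t : ℝ))).Nonempty
      · obtain ⟨p, hpm, hpmax⟩ := Finset.exists_max_image _ id hne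
        rw [Finset.mem_filter] at hpm
        obtain ⟨hpS, hp0, hpt⟩ := hpm
        let q : unitInterval := ⟨p, hp0.le, hpt.le.trans t.2.2⟩
        refine key q t hpt ?_ (hS p hpS) ((ih _ ?_ q rfl).1 (hS p hpS))
        · intro s hs hmem
          have := hpmax s (Finset.mem_filter.2 ⟨hs, hp0.trans hmem.1, hmem.2⟩)
          exact absurd hmem.1 (not_lt.2 this)
        · rw [← ht]
          apply Finset.card_lt_card
          refine ⟨?_, ?_⟩
          · intro s hs
            rw [Finset.mem_filter] at hs ⊢
            exact ⟨hs.1, lt_trans hs.2 hpt⟩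
          · intro hsub
            have := hsub (Finset.mem_filter.2 ⟨hpS, hpt⟩)
            rw [Finset.mem_filter] at this
            exact lt_irrefl _ this.2
      · refine key 0 t hpos ?_ isDyadic_zero (by rw [h0]; exact isDyadic_zero)
        intro s hs hmem
        exact hne ⟨s, Finset.mem_filter.2 ⟨hs, hmem⟩⟩
  exact main _ t rfl

theorem IsDyadic.projIcc {s : ℝ} (hs : IsDyadic s) :
    IsDyadic ((Set.projIcc (0 : ℝ) 1 zero_le_one s : unitInterval) : ℝ) := by
  rw [Set.coe_projIcc]
  rcases max_choice (0 : ℝ) (min 1 s) with h | h <;> rw [h]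
  · exact isDyadic_zero
  · rcases min_choice (1 : ℝ) s with h | h <;> rw [h]
    · exact isDyadic_one
    · exact hs

theorem isThompson_one : IsThompson 1 :=
  ⟨∅, by simp, fun a b _ _ => ⟨0, 0, fun t _ => by simp⟩⟩

theorem IsThompson.mul {f g : unitInterval ≃o unitInterval} (hf : IsThompson f)
    (hg : IsThompson g) : IsThompson (f * g) := by
  have hgd := hg.isDyadic_iff
  obtain ⟨S, hS, hf⟩ := hf
  obtain ⟨T, hT, hg⟩ := hg
  classical
  refine ⟨T ∪ S.image
    (fun s => ((g.symm (Set.projIcc (0 : ℝ) 1 zero_le_one s) : unitInterval) : ℝ)), ?_, ?_⟩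
  · intro s hs
    rw [Finset.mem_union, Finset.mem_image] at hs
    rcases hs with hs | ⟨s, hs, rfl⟩
    · exact hT s hs
    · rw [hgd, OrderIso.apply_symm_apply]
      exact (hS s hs).projIcc
  · intro a b hab hs
    obtain ⟨k, c, hk⟩ := hg a b hab (fun s h => hs s (Finset.mem_union_left _ h))
    obtain ⟨k', c', hk'⟩ := hf (g a) (g b) (g.lt_iff_lt.2 hab) (by
      intro s h hmem
      have hsI : s ∈ Icc (0 : ℝ) 1 := ⟨(g a).2.1.trans hmem.1.le, hmem.2.le.trans (g b).2.2⟩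
      refine hs _ (Finset.mem_union_right _ (Finset.mem_image.2 ⟨s, h, rfl⟩)) ?_
      rw [Set.projIcc_of_mem _ hsI]
      constructor
      · exact g.lt_symm_apply.2 hmem.1
      · exact g.symm_apply_lt.2 hmem.2)
    refine ⟨k' + k, 2 ^ k' * c + c', fun t ht => ?_⟩
    have h1 := hk t ht
    have h2 := hk' (g t) ⟨g.le_iff_le.2 ht.1, g.le_iff_le.2 ht.2⟩
    change (f (g t) : ℝ) = _
    rw [h2, h1, zpow_add₀ two_ne_zero]
    ring

theorem IsThompson.inv {f : unitInterval ≃o unitInterval} (hf : IsThompson f) :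
    IsThompson f⁻¹ := by
  have hfd := hf.isDyadic_iff
  obtain ⟨S, hS, hf⟩ := hf
  classical
  refine ⟨S.image
    (fun s => ((f (Set.projIcc (0 : ℝ) 1 zero_le_one s) : unitInterval) : ℝ)), ?_, ?_⟩
  · intro s hs
    rw [Finset.mem_image] at hs
    obtain ⟨s, hs, rfl⟩ := hs
    rw [← hfd]
    exact (hS s hs).projIcc
  · intro a b hab hs
    obtain ⟨k, c, hk⟩ := hf (f.symm a) (f.symm b) (f.symm.lt_iff_lt.2 hab) (by
      intro s h hmem
      have hsI : s ∈ Icc (0 : ℝ) 1 :=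
        ⟨(f.symm a).2.1.trans hmem.1.le, hmem.2.le.trans (f.symm b).2.2⟩
      refine hs _ (Finset.mem_image.2 ⟨s, h, rfl⟩) ?_
      rw [Set.projIcc_of_mem _ hsI]
      constructor
      · exact f.symm_apply_lt.1 hmem.1
      · exact f.lt_symm_apply.1 hmem.2)
    refine ⟨-k, -(2 ^ (-k) * c), fun t ht => ?_⟩
    have h1 := hk (f.symm t) ⟨f.symm.le_iff_le.2 ht.1, f.symm.le_iff_le.2 ht.2⟩
    rw [OrderIso.apply_symm_apply] at h1
    change (f.symm t : ℝ) = _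
    rw [h1, zpow_neg]
    field_simp
    ring

/-- Thompson's group `F`; the product is composition, `(f * g) t = f (g t)`. -/
def thompsonF : Subgroup (unitInterval ≃o unitInterval) where
  carrier := {f | IsThompson f}
  one_mem' := isThompson_one
  mul_mem' := fun hf hg => IsThompson.mul hf hg
  inv_mem' := fun hf => IsThompson.inv hf

/-- The explicit piecewise formula for the standard generator `x_n`. -/
noncomputable def thompsonGenFun (n : ℕ) (t : ℝ) : ℝ :=
  if t ≤ (2 ^ n - 1) / 2 ^ n then t
  else if t ≤ (2 ^ (n + 1) - 1) / 2 ^ (n + 1) then 1 / 2 * t + (2 ^ n - 1) / 2 ^ (n + 1)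
  else if t ≤ (2 ^ (n + 2) - 1) / 2 ^ (n + 2) then t - 1 / 2 ^ (n + 2)
  else 2 * t - 1

theorem thompsonGenFun_eq (n : ℕ) : ∃ d : ℝ, 0 < d ∧ d ≤ 1 ∧ d = 1 / 2 ^ n ∧
    ∀ t, thompsonGenFun n t =
      if t ≤ 1 - d then t
      else if t ≤ 1 - d / 2 then t / 2 + (1 - d) / 2
      else if t ≤ 1 - d / 4 then t - d / 4
      else 2 * t - 1 := by
  refine ⟨1 / 2 ^ n, by positivity, ?_, rfl, fun t => ?_⟩
  · rw [div_le_one (by positivity)]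
    exact one_le_pow₀ one_le_two
  · have h : (2 : ℝ) ^ n ≠ 0 := by positivity
    have e1 : ((2 : ℝ) ^ n - 1) / 2 ^ n = 1 - 1 / 2 ^ n := by field_simp
    have e2 : ((2 : ℝ) ^ (n + 1) - 1) / 2 ^ (n + 1) = 1 - 1 / 2 ^ n / 2 := by
      rw [pow_succ]; field_simp
    have e3 : ((2 : ℝ) ^ (n + 2) - 1) / 2 ^ (n + 2) = 1 - 1 / 2 ^ n / 4 := by
      rw [pow_add]; field_simp; ring
    have e4 : ((2 : ℝ) ^ n - 1) / 2 ^ (n + 1) = (1 - 1 / 2 ^ n) / 2 := by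
      rw [pow_succ]; field_simp
    have e5 : (1 : ℝ) / 2 ^ (n + 2) = 1 / 2 ^ n / 4 := by
      rw [pow_add]; field_simp; norm_num
    rw [thompsonGenFun, e1, e2, e3, e4, e5, one_div_mul_eq_div]

theorem thompsonGenFun_strictMono (n : ℕ) : StrictMono (thompsonGenFun n) := by
  obtain ⟨d, hd, -, -, h⟩ := thompsonGenFun_eq n
  intro s t hst
  rw [h, h]
  split_ifs <;> linarith

theorem thompsonGenFun_mem (n : ℕ) (t : unitInterval) :
    thompsonGenFun n t ∈ unitInterval := by
  obtain ⟨d, hd, hd1, -, h⟩ := thompsonGenFun_eq n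
  have h0 := t.2.1
  have h1 := t.2.2
  rw [h]
  split_ifs <;> constructor <;> linarith

theorem thompsonGenFun_surj (n : ℕ) (y : unitInterval) :
    ∃ t : unitInterval, thompsonGenFun n t = y := by
  obtain ⟨d, hd, hd1, -, h⟩ := thompsonGenFun_eq n
  have h0 := y.2.1
  have h1 := y.2.2
  by_cases c1 : (y : ℝ) ≤ 1 - d
  · exact ⟨y, by rw [h, if_pos c1]⟩
  by_cases c2 : (y : ℝ) ≤ 1 - 3 * d / 4
  · refine ⟨⟨2 * y - (1 - d), by linarith, by linarith⟩, ?_⟩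
    rw [h]
    split_ifs <;> linarith
  by_cases c3 : (y : ℝ) ≤ 1 - d / 2
  · refine ⟨⟨y + d / 4, by linarith, by linarith⟩, ?_⟩
    rw [h]
    split_ifs <;> linarith
  · refine ⟨⟨(y + 1) / 2, by linarith, by linarith⟩, ?_⟩
    rw [h]
    split_ifs <;> linarith

/-- The homeomorphism of `[0,1]` given by the formula for `x_n`. -/
noncomputable def thompsonGenIso (n : ℕ) : unitInterval ≃o unitInterval :=
  StrictMono.orderIsoOfSurjective
    (fun t : unitInterval => (⟨thompsonGenFun n t, thompsonGenFun_mem n t⟩ : unitInterval))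
    (fun _ _ hst => thompsonGenFun_strictMono n hst)
    (fun y => (thompsonGenFun_surj n y).imp fun _ ht => Subtype.ext ht)

theorem thompsonGenIso_apply (n : ℕ) (t : unitInterval) :
    (thompsonGenIso n t : ℝ) = thompsonGenFun n t := rfl

theorem isThompson_thompsonGenIso (n : ℕ) : IsThompson (thompsonGenIso n) := by
  obtain ⟨d, hd, -, hdn, h⟩ := thompsonGenFun_eq n
  have dd : IsDyadic d := ⟨1, n, by rw [hdn]; simp⟩
  have d2 : IsDyadic (d / 2) := by
    have := dd.zpow_mul (-1)
    rwa [zpow_neg_one, inv_mul_eq_div] at this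
  have d4 : IsDyadic (d / 4) := by
    have := d2.zpow_mul (-1)
    rw [zpow_neg_one, inv_mul_eq_div] at this
    convert this using 1
    ring
  refine ⟨{1 - d, 1 - d / 2, 1 - d / 4}, ?_, ?_⟩
  · intro s hs
    simp only [Finset.mem_insert, Finset.mem_singleton] at hs
    rcases hs with rfl | rfl | rfl
    · exact isDyadic_one.sub dd
    · exact isDyadic_one.sub d2
    · exact isDyadic_one.sub d4
  · intro a b hab hs
    have hab' : (a : ℝ) < b := hab
    have s1 := hs (1 - d) (by simp)
    have s2 := hs (1 - d / 2) (by simp)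
    have s3 := hs (1 - d / 4) (by simp)
    simp only [mem_Ioo, not_and_or, not_lt] at s1 s2 s3
    have e : ∀ (k : ℤ) (c : ℝ),
        (∀ t : ℝ, (a : ℝ) ≤ t → t ≤ b → thompsonGenFun n t = 2 ^ k * t + c) →
        ∃ (k : ℤ) (c : ℝ), ∀ t ∈ Icc a b, (thompsonGenIso n t : ℝ) = 2 ^ k * (t : ℝ) + c :=
      fun k c H => ⟨k, c, fun t ht => H t ht.1 ht.2⟩
    rcases s1 with s1 | s1
    · rcases s2 with s2 | s2
      · rcases s3 with s3 | s3
        · refine e 1 (-1) fun t ha hb => ?_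
          rw [h, zpow_one]
          split_ifs <;> linarith
        · refine e 0 (-(d / 4)) fun t ha hb => ?_
          rw [h, zpow_zero]
          split_ifs <;> linarith
      · refine e (-1) ((1 - d) / 2) fun t ha hb => ?_
        rw [h, zpow_neg_one]
        split_ifs <;> linarith
    · refine e 0 0 fun t ha hb => ?_
      rw [h, zpow_zero]
      split_ifs <;> linarith

/-- The standard generator `x_n` of `F`. -/
noncomputable def thompsonX (n : ℕ) : thompsonF :=
  ⟨thompsonGenIso n, isThompson_thompsonGenIso n⟩

/-- The support `{t ∈ [0,1] | f t ≠ t}`. -/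
def thompsonSupp (f : thompsonF) : Set unitInterval := {t | f.1 t ≠ t}

/-- The subgroup `H₁` of all `f ∈ F` with `1 ∉ closure (supp f)`. -/
def thompsonH1 : Subgroup thompsonF where
  carrier := {f | (1 : unitInterval) ∉ closure (thompsonSupp f)}
  one_mem' := by
    have : thompsonSupp 1 = ∅ := by
      ext t
      simp [thompsonSupp]
    simp [this]
  mul_mem' := by
    intro f g hf hg h
    have hsub : thompsonSupp (f * g) ⊆ thompsonSupp f ∪ thompsonSupp g := by
      intro t ht
      by_contra hcon
      simp only [thompsonSupp, mem_union, mem_ofPred_eq, not_or, not_not] at hcon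
      apply ht
      change f.1 (g.1 t) = t
      rw [hcon.2, hcon.1]
    have h' := closure_mono hsub h
    rw [closure_union] at h'
    exact h'.elim hf hg
  inv_mem' := by
    intro f hf h
    apply hf
    have hsub : thompsonSupp f⁻¹ ⊆ thompsonSupp f := by
      intro t ht h2
      apply ht
      change f.1.symm t = t
      rw [OrderIso.symm_apply_eq, h2]
    exact closure_mono hsub h

/-! ### HNN-extensions with trivial action of the stable letter -/

/-- The centralized HNN-extension `⟨G, g | g h g⁻¹ = h, h ∈ H⟩`; its stable letter `g` is
`HNNExtension.t`, and `HNNExtension.of` is the natural map from `G`. -/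
abbrev CentralizedHNN (G : Type*) [Group G] (H : Subgroup G) : Type _ :=
  HNNExtension G H H (MulEquiv.refl H)

/-! ### The space of marked groups -/

/-- A group together with a generating `n`-tuple. -/
structure MarkedGroup (n : ℕ) where
  carrier : Type
  [group : Group carrier]
  gen : Fin n → carrier
  closure_gen : Subgroup.closure (Set.range gen) = ⊤

attribute [instance] MarkedGroup.group

namespace MarkedGroup

variable {n : ℕ}

/-- The relations of a marked group: the words in the `n` generators that are trivial in it. -/
def relations (G : MarkedGroup n) : Subgroup (FreeGroup (Fin n)) :=
  (FreeGroup.lift G.gen).ker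

/-- The two marked groups have the same relations of length at most `R`. -/
def SameRelations (R : ℕ) (G G' : MarkedGroup n) : Prop :=
  ∀ w : FreeGroup (Fin n), w.norm ≤ R → (w ∈ G.relations ↔ w ∈ G'.relations)

/-- Isomorphism of marked groups: an isomorphism of groups which respects the markings. -/
def Iso (G G' : MarkedGroup n) : Prop :=
  ∃ e : G.carrier ≃* G'.carrier, ∀ i, e (G.gen i) = G'.gen i

theorem iso_equivalence : Equivalence (Iso (n := n)) where
  refl G := ⟨MulEquiv.refl _, fun _ => rfl⟩
  symm := fun ⟨e, h⟩ => ⟨e.symm, fun i => by rw [← h, e.symm_apply_apply]⟩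
  trans := fun ⟨e, h⟩ ⟨e', h'⟩ => ⟨e.trans e', fun i => by simp [h, h']⟩

instance setoid (n : ℕ) : Setoid (MarkedGroup n) := ⟨Iso, iso_equivalence⟩

theorem lift_surjective (G : MarkedGroup n) : Function.Surjective (FreeGroup.lift G.gen) := by
  rw [← MonoidHom.range_eq_top, FreeGroup.range_lift_eq_closure, G.closure_gen]

theorem iso_iff_relations_eq (G G' : MarkedGroup n) : Iso G G' ↔ G.relations = G'.relations := by
  constructor
  · rintro ⟨e, h⟩
    have : FreeGroup.lift G'.gen = e.toMonoidHom.comp (FreeGroup.lift G.gen) := by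
      ext i
      simp [h]
    ext w
    simp [relations, this]
  · intro h
    have hG : ∀ i, QuotientGroup.quotientKerEquivOfSurjective _ G.lift_surjective
        (QuotientGroup.mk (FreeGroup.of i)) = G.gen i := fun i =>
      (QuotientGroup.kerLift_mk (FreeGroup.lift G.gen) (FreeGroup.of i)).trans
        FreeGroup.lift_apply_of
    have hG' : ∀ i, QuotientGroup.quotientKerEquivOfSurjective _ G'.lift_surjective
        (QuotientGroup.mk (FreeGroup.of i)) = G'.gen i := fun i =>
      (QuotientGroup.kerLift_mk (FreeGroup.lift G'.gen) (FreeGroup.of i)).trans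
        FreeGroup.lift_apply_of
    have h' : (FreeGroup.lift G.gen).ker = (FreeGroup.lift G'.gen).ker := h
    refine ⟨(QuotientGroup.quotientKerEquivOfSurjective _ G.lift_surjective).symm.trans
      ((QuotientGroup.quotientMulEquivOfEq h').trans
        (QuotientGroup.quotientKerEquivOfSurjective _ G'.lift_surjective)), fun i => ?_⟩
    rw [← hG i, ← hG' i]
    simp only [MulEquiv.trans_apply, MulEquiv.symm_apply_apply]
    rfl

theorem sameRelations_zero (G G' : MarkedGroup n) : SameRelations 0 G G' := by
  intro w hw
  have : w = 1 := FreeGroup.norm_eq_zero.1 (Nat.le_zero.1 hw)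
  subst this
  simp [one_mem]

/-- The distance of two marked groups: the infimum of the numbers `e^{-R}` over all `R` such that
the two groups have the same relations of length at most `R`. -/
noncomputable def distance (G G' : MarkedGroup n) : ℝ :=
  sInf {r : ℝ | ∃ R : ℕ, SameRelations R G G' ∧ r = Real.exp (-(R : ℝ))}

theorem distance_bddBelow (G G' : MarkedGroup n) :
    BddBelow {r : ℝ | ∃ R : ℕ, SameRelations R G G' ∧ r = Real.exp (-(R : ℝ))} :=
  ⟨0, by rintro _ ⟨R, -, rfl⟩; positivity⟩

theorem distance_nonempty (G G' : MarkedGroup n) :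
    {r : ℝ | ∃ R : ℕ, SameRelations R G G' ∧ r = Real.exp (-(R : ℝ))}.Nonempty :=
  ⟨_, 0, sameRelations_zero G G', rfl⟩

theorem distance_nonneg (G G' : MarkedGroup n) : 0 ≤ distance G G' :=
  Real.sInf_nonneg (by rintro _ ⟨R, -, rfl⟩; positivity)

theorem SameRelations.mono {R R' : ℕ} {G G' : MarkedGroup n} (h : SameRelations R G G')
    (hR : R' ≤ R) : SameRelations R' G G' := fun w hw => h w (hw.trans hR)

/-- Two marked groups are at distance at most `e^{-R}` if and only if they have the same relations
of length at most `R`. -/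
theorem distance_le_iff (R : ℕ) (G G' : MarkedGroup n) :
    distance G G' ≤ Real.exp (-(R : ℝ)) ↔ SameRelations R G G' := by
  constructor
  · intro h
    by_contra hR
    have hlt : ∀ R' : ℕ, SameRelations R' G G' → R' + 1 ≤ R := by
      intro R' h'
      by_contra hc
      exact hR (h'.mono (by omega))
    have h1 : Real.exp (-((R : ℝ) - 1)) ≤ distance G G' := by
      refine le_csInf (distance_nonempty G G') ?_
      rintro _ ⟨R', h', rfl⟩
      have : ((R' + 1 : ℕ) : ℝ) ≤ R := by exact_mod_cast hlt R' h'
      push_cast at this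
      exact Real.exp_le_exp.2 (by linarith)
    have h2 := Real.exp_le_exp.1 (h1.trans h)
    linarith
  · intro h
    exact csInf_le (distance_bddBelow G G') ⟨R, h, rfl⟩

theorem distance_self (G : MarkedGroup n) : distance G G = 0 := by
  refine le_antisymm (le_of_forall_pos_le_add fun ε hε => ?_) (distance_nonneg G G)
  obtain ⟨R, hR⟩ := exists_nat_gt (-Real.log ε)
  have h1 := (distance_le_iff R G G).2 (fun _ _ => Iff.rfl)
  have h2 : Real.exp (-(R : ℝ)) ≤ ε := by
    rw [← Real.exp_log hε]
    exact Real.exp_le_exp.2 (by linarith)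
  linarith

theorem sameRelations_comm (R : ℕ) (G G' : MarkedGroup n) :
    SameRelations R G G' ↔ SameRelations R G' G :=
  ⟨fun h w hw => (h w hw).symm, fun h w hw => (h w hw).symm⟩

theorem distance_comm (G G' : MarkedGroup n) : distance G G' = distance G' G := by
  simp only [distance, sameRelations_comm _ G G']

theorem distance_triangle (G G' G'' : MarkedGroup n) :
    distance G G'' ≤ distance G G' + distance G' G'' := by
  have key : ∀ R R' : ℕ, SameRelations R G G' → SameRelations R' G' G'' →
      distance G G'' ≤ Real.exp (-(R : ℝ)) + Real.exp (-(R' : ℝ)) := by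
    intro R R' h h'
    have p := Real.exp_pos (-(R : ℝ))
    have p' := Real.exp_pos (-(R' : ℝ))
    rcases le_total R R' with hle | hle
    · have := (distance_le_iff R G G'').2 fun w hw => (h w hw).trans (h' w (hw.trans hle))
      linarith
    · have := (distance_le_iff R' G G'').2 fun w hw => (h w (hw.trans hle)).trans (h' w hw)
      linarith
  have h1 : distance G G'' - distance G G' ≤ distance G' G'' := by
    refine le_csInf (distance_nonempty G' G'') ?_
    rintro _ ⟨R', h', rfl⟩
    have h2 : distance G G'' - Real.exp (-(R' : ℝ)) ≤ distance G G' := by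
      refine le_csInf (distance_nonempty G G') ?_
      rintro _ ⟨R, h, rfl⟩
      have := key R R' h h'
      linarith
    linarith
  linarith

theorem iso_of_distance_eq_zero {G G' : MarkedGroup n} (h : distance G G' = 0) : Iso G G' := by
  rw [iso_iff_relations_eq]
  ext w
  exact (distance_le_iff w.norm G G').1 (by rw [h]; positivity) w le_rfl

theorem distance_congr {G₁ G₂ G₁' G₂' : MarkedGroup n} (h : Iso G₁ G₁') (h' : Iso G₂ G₂') :
    distance G₁ G₂ = distance G₁' G₂' := by
  rw [iso_iff_relations_eq] at h h'
  simp only [distance, SameRelations, h, h']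

end MarkedGroup

/-- The space of groups marked by `n` generators, up to isomorphism of marked groups. -/
def MarkedGroupSpace (n : ℕ) : Type 1 := Quotient (MarkedGroup.setoid n)

namespace MarkedGroupSpace

noncomputable instance (n : ℕ) : MetricSpace (MarkedGroupSpace n) where
  dist := Quotient.lift₂ MarkedGroup.distance
    (fun _ _ _ _ h h' => MarkedGroup.distance_congr h h')
  dist_self := by rintro ⟨G⟩; exact MarkedGroup.distance_self G
  dist_comm := by rintro ⟨G⟩ ⟨G'⟩; exact MarkedGroup.distance_comm G G'
  dist_triangle := by
    rintro ⟨G⟩ ⟨G'⟩ ⟨G''⟩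
    exact MarkedGroup.distance_triangle G G' G''
  eq_of_dist_eq_zero := by
    rintro ⟨G⟩ ⟨G'⟩ h
    exact Quotient.sound (MarkedGroup.iso_of_distance_eq_zero h)

/-- The point `(G, (s 0, …, s (n - 1)))` of the space of marked groups. -/
def mk {n : ℕ} (G : Type) [Group G] (s : Fin n → G)
    (hs : Subgroup.closure (Set.range s) = ⊤) : MarkedGroupSpace n :=
  Quotient.mk (MarkedGroup.setoid n) ⟨G, s, hs⟩

end MarkedGroupSpace

/-!
The quotient of `F` by `H₁` is infinite cyclic, generated by the image of `x₀`: an element of `F`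
is determined near `1` by its slope there. As the stable letter `t` commutes with the normal
subgroup `H₁`, its conjugates by elements of `F` are the elements `x₀ⁱ t x₀⁻ⁱ`, and every element
of the HNN-extension is `u(x₀ⁱ t x₀⁻ⁱ) f` with `u` in the free group on `ℤ` and `f ∈ F`
(`exists_conjWord_mul_of`).

The `g n` are chosen in `H₁` with support in a neighbourhood of `1` that shrinks with `n`. Then
every element of `H₁` commutes with `g n` for large `n`, so `t ↦ (g n)` defines a homomorphism
from the HNN-extension to the group of germs at infinity of sequences in `F` (`germHom`), and
every relation of the limit holds eventually. Conversely let `u(x₀ⁱ t x₀⁻ⁱ) f ≠ 1`. If `u = 1`,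
then `f ≠ 1` and there is nothing to show; if `f ∉ H₁`, then `u(x₀ⁱ (g n) x₀⁻ⁱ) f ≠ 1` since `g n`
lies in the normal subgroup `H₁`. Otherwise `f` is the identity near `1`, and it suffices that
`u(x₀ⁱ (g n) x₀⁻ⁱ)` moves points close to `1` (`exists_moving`). For `j > 0`, `x₀` maps `[1 -
2⁻ʲ⁻¹, 1 - 2⁻ʲ⁻²]` affinely onto `[1 - 2⁻ʲ, 1 - 2⁻ʲ⁻¹]`. So `g n` can be prescribed independently
on a long row of these intervals, and on one of them the conjugates `x₀ⁱ (g n) x₀⁻ⁱ` act as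
arbitrary elements `f i` of a copy of `F`. Hence the claim reduces to the fact that `F` satisfies
no law (`exists_substitution`), which holds since a reduced word can be made to push a point
steadily in one direction.

That `x₀` and `x₁` generate `F` (`closure_thompsonX_eq_top`) is seen on `[0, ∞)`, where `F` acts
after the intervals `[1 - 2⁻ʲ, 1 - 2⁻ʲ⁻¹]` have been rescaled to `[j, j + 1]`: the inverses of the
`x_n` double one unit interval and translate what lies to the right, so their products stretch
unit intervals by arbitrary powers of `2`, and every element of `F` becomes such a product after
composition with magnifications of a long initial interval on both sides.

A finite subset of `H₁` has a common neighbourhood of `1` on which it is the identity, while `H₁`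
contains elements that move points arbitrarily close to `1`; so `H₁` is not finitely generated.
-/

open scoped NNReal

/-! ### The coordinate on `[0, ∞)` -/

/-- The affine map `[j, j + 1] → [1 - 2⁻ʲ, 1 - 2⁻ʲ⁻¹]` on each piece: a homeomorphism of `[0, ∞)`
onto `[0, 1)` that carries the dyadic numbers onto the dyadic numbers. -/
noncomputable def comb (s : ℝ) : ℝ := 1 - 2 ^ (-⌊s⌋) * (1 - Int.fract s / 2)

theorem comb_add_int (s : ℝ) (k : ℤ) : comb (s + k) = 1 - 2 ^ (-k) * (1 - comb s) := by
  simp only [comb, Int.floor_add_intCast, Int.fract_add_intCast, neg_add,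
    zpow_add₀ (two_ne_zero (α := ℝ))]
  ring

theorem comb_of_mem_unit {s : ℝ} (h0 : 0 ≤ s) (h1 : s ≤ 1) : comb s = s / 2 := by
  rcases h1.lt_or_eq with h | rfl
  · rw [comb, Int.floor_eq_zero_iff.2 ⟨h0, h⟩, Int.fract_eq_self.2 ⟨h0, h⟩]
    simp
  · norm_num [comb]

theorem comb_natCast_add (j : ℕ) {u : ℝ} (h0 : 0 ≤ u) (h1 : u ≤ 1) :
    comb (j + u) = 1 - (1 - u / 2) / 2 ^ j := by
  have := comb_add_int u j
  rw [Int.cast_natCast, add_comm] at this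
  rw [this, comb_of_mem_unit h0 h1, zpow_neg, zpow_natCast]
  field_simp

theorem comb_lt_one (s : ℝ) : comb s < 1 := by
  have h1 := Int.fract_lt_one s
  have : (0 : ℝ) < 2 ^ (-⌊s⌋) * (1 - Int.fract s / 2) := by
    have : (0 : ℝ) < 1 - Int.fract s / 2 := by linarith
    positivity
  rw [comb]; linarith

theorem exists_nat_add (s : ℝ≥0) : ∃ (j : ℕ) (u : ℝ≥0), u < 1 ∧ s = j + u := by
  refine ⟨⌊s⌋₊, s - ⌊s⌋₊, ?_, ?_⟩
  · rw [tsub_lt_iff_left (Nat.floor_le zero_le)]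
    exact Nat.lt_floor_add_one s
  · rw [add_tsub_cancel_of_le (Nat.floor_le zero_le)]

theorem comb_strictMono : StrictMono fun s : ℝ≥0 => comb s := by
  intro s t hst
  obtain ⟨j, u, hu, rfl⟩ := exists_nat_add s
  obtain ⟨k, v, hv, rfl⟩ := exists_nat_add t
  have hu' : (u : ℝ) < 1 := hu
  have hv' : (v : ℝ) < 1 := hv
  have hst' : (j : ℝ) + u < k + v := by exact_mod_cast hst
  simp only [NNReal.coe_add, NNReal.coe_natCast]
  rw [comb_natCast_add j u.coe_nonneg hu'.le, comb_natCast_add k v.coe_nonneg hv'.le]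
  have hv0 : (0 : ℝ) ≤ v := v.coe_nonneg
  have hu0 : (0 : ℝ) ≤ u := u.coe_nonneg
  have hjk : j ≤ k := by
    have : (j : ℝ) < k + 1 := by linarith
    exact Nat.lt_succ_iff.1 (by exact_mod_cast this)
  rcases hjk.lt_or_eq with h | rfl
  · have h2 : (2 : ℝ) ^ (j + 1) ≤ 2 ^ k := pow_le_pow_right₀ one_le_two h
    have h3 : (1 - (v : ℝ) / 2) / 2 ^ k ≤ (1 - (v : ℝ) / 2) / 2 ^ (j + 1) :=
      div_le_div_of_nonneg_left (by linarith) (by positivity) h2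
    have h4 : (1 - (v : ℝ) / 2) / 2 ^ (j + 1) < (1 - (u : ℝ) / 2) / 2 ^ j := by
      rw [pow_succ, div_lt_div_iff₀ (by positivity) (by positivity)]
      have : (0 : ℝ) < 2 ^ j := by positivity
      nlinarith
    linarith
  · have : (1 - (v : ℝ) / 2) / 2 ^ j < (1 - (u : ℝ) / 2) / 2 ^ j :=
      div_lt_div_of_pos_right (by linarith) (by positivity)
    linarith

theorem comb_nonneg (s : ℝ≥0) : 0 ≤ comb s := by
  have := comb_strictMono.monotone (zero_le (a := s))
  simpa [comb] using this

theorem exists_comb_eq {t : ℝ} (h0 : 0 ≤ t) (h1 : t < 1) : ∃ s : ℝ≥0, comb s = t := by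
  obtain ⟨j, hj1, hj2⟩ := exists_nat_pow_near_of_lt_one (x := 1 - t) (y := (1 / 2 : ℝ))
    (by linarith) (by linarith) (by norm_num) (by norm_num)
  rw [one_div, inv_pow] at hj1 hj2
  have hp : (0 : ℝ) < 2 ^ j := by positivity
  have e1 : 2 ^ j * (1 - t) ≤ 1 := by
    calc 2 ^ j * (1 - t) ≤ 2 ^ j * (2 ^ j)⁻¹ := by gcongr
      _ = 1 := mul_inv_cancel₀ hp.ne'
  have e2 : 1 / 2 < 2 ^ j * (1 - t) := by
    calc (1 / 2 : ℝ) = 2 ^ j * (2 ^ (j + 1))⁻¹ := by rw [pow_succ]; field_simp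
      _ < _ := by gcongr
  have h2 : 0 ≤ 2 * (1 - 2 ^ j * (1 - t)) := by linarith
  refine ⟨j + (2 * (1 - 2 ^ j * (1 - t))).toNNReal, ?_⟩
  rw [NNReal.coe_add, NNReal.coe_natCast, Real.coe_toNNReal _ h2,
    comb_natCast_add j h2 (by linarith)]
  field_simp
  ring

/-- `comb` as a map into the unit interval. -/
noncomputable def combI (s : ℝ≥0) : unitInterval := ⟨comb s, comb_nonneg s, (comb_lt_one _).le⟩

theorem combI_strictMono : StrictMono combI := fun _ _ h => comb_strictMono h

theorem combI_lt_one (s : ℝ≥0) : combI s < 1 := comb_lt_one s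

theorem exists_combI_eq {t : unitInterval} (h : t < 1) : ∃ s, combI s = t := by
  obtain ⟨s, hs⟩ := exists_comb_eq t.2.1 h
  exact ⟨s, Subtype.ext hs⟩

theorem thompsonF_apply_combI_lt (f : thompsonF) (s : ℝ≥0) : f.1 (combI s) < 1 := by
  have h1 : f.1 1 = 1 := f.1.map_top
  rw [← h1]
  exact f.1.lt_iff_lt.2 (combI_lt_one s)

theorem combI_invFun {t : unitInterval} (h : t < 1) : combI (Function.invFun combI t) = t :=
  Function.invFun_eq (exists_combI_eq h)

/-- The action of `F` on `[0, ∞)`, obtained from its action on `[0, 1)` through `combI`. -/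
noncomputable instance : MulAction thompsonF ℝ≥0 where
  smul f s := Function.invFun combI (f.1 (combI s))
  one_smul s := Function.leftInverse_invFun combI_strictMono.injective s
  mul_smul f g s := by
    change Function.invFun combI (f.1 (g.1 (combI s))) = Function.invFun combI
      (f.1 (combI (Function.invFun combI (g.1 (combI s)))))
    rw [combI_invFun (thompsonF_apply_combI_lt g s)]

theorem combI_smul (f : thompsonF) (s : ℝ≥0) : combI (f • s) = f.1 (combI s) :=
  combI_invFun (thompsonF_apply_combI_lt f s)

theorem comb_smul (f : thompsonF) (s : ℝ≥0) : comb (f • s : ℝ≥0) = f.1 (combI s) :=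
  congrArg Subtype.val (combI_smul f s)

theorem smul_eq_of_comb {f : thompsonF} {s s' : ℝ≥0} (h : (f.1 (combI s) : ℝ) = comb s') :
    f • s = s' :=
  comb_strictMono.injective (by simpa only [comb_smul] using h)

theorem thompsonF_smul_lt_smul_iff (f : thompsonF) {s t : ℝ≥0} : f • s < f • t ↔ s < t := by
  rw [← combI_strictMono.lt_iff_lt, combI_smul, combI_smul, f.1.lt_iff_lt,
    combI_strictMono.lt_iff_lt]

theorem thompsonF_smul_le_smul_iff (f : thompsonF) {s t : ℝ≥0} : f • s ≤ f • t ↔ s ≤ t := by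
  rw [← not_lt, thompsonF_smul_lt_smul_iff, not_lt]

theorem thompsonF_smul_zero (f : thompsonF) : f • (0 : ℝ≥0) = 0 := by
  apply smul_eq_of_comb
  have h0 : f.1 0 = 0 := f.1.map_bot
  have : combI 0 = 0 := Subtype.ext (by simp [combI, comb])
  rw [this, h0]
  simp [comb]

/-- The action on `[0, ∞)` is faithful. -/
theorem eq_of_smul_eq {f g : thompsonF} (h : ∀ s : ℝ≥0, f • s = g • s) : f = g := by
  apply Subtype.ext
  apply DFunLike.ext
  intro t
  rcases (unitInterval.le_one' (t := t)).lt_or_eq with ht | rfl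
  · obtain ⟨s, rfl⟩ := exists_combI_eq ht
    rw [← combI_smul, ← combI_smul, h]
  · exact f.1.map_top.trans g.1.map_top.symm

/-! ### The generators in the new coordinate -/

theorem thompsonX_smul_of_le (n : ℕ) {s : ℝ≥0} (h : s ≤ n) : thompsonX n • s = s := by
  apply smul_eq_of_comb
  change thompsonGenFun n (comb s) = comb s
  obtain ⟨d, hd, hd1, hdn, H⟩ := thompsonGenFun_eq n
  have h1 : comb s ≤ comb (n : ℝ≥0) := comb_strictMono.monotone h
  have h2 := comb_natCast_add n (le_refl (0 : ℝ)) zero_le_one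
  simp only [NNReal.coe_natCast] at h1
  rw [add_zero] at h2
  rw [H, if_pos]
  rw [hdn]
  simpa [h2] using h1

theorem thompsonX_smul_double (n : ℕ) {u : ℝ≥0} (h : u ≤ 1) :
    thompsonX n • (n + 2 * u) = n + u := by
  apply smul_eq_of_comb
  change thompsonGenFun n (comb (n + 2 * u : ℝ≥0)) = comb (n + u : ℝ≥0)
  obtain ⟨d, hd, hd1, hdn, H⟩ := thompsonGenFun_eq n
  have h' : (u : ℝ) ≤ 1 := h
  have hu : (0 : ℝ) ≤ u := u.coe_nonneg
  push_cast
  rw [comb_natCast_add n hu h', H]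
  rcases le_total (2 * u : ℝ) 1 with h2 | h2
  · rw [comb_natCast_add n (by positivity) h2, div_eq_mul_one_div _ ((2 : ℝ) ^ n),
      div_eq_mul_one_div (1 - (u : ℝ) / 2) ((2 : ℝ) ^ n), ← hdn]
    split_ifs <;> nlinarith
  · have := comb_natCast_add (n + 1) (u := 2 * u - 1) (by linarith) (by linarith)
    rw [show (((n + 1 : ℕ) : ℝ) + (2 * u - 1)) = n + 2 * u by push_cast; ring, pow_succ,
      div_mul_eq_div_div_swap, div_eq_mul_one_div _ ((2 : ℝ) ^ n), ← hdn] at this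
    rw [this, div_eq_mul_one_div _ ((2 : ℝ) ^ n), ← hdn]
    split_ifs <;> nlinarith

theorem thompsonX_smul_add (n : ℕ) (u : ℝ≥0) :
    thompsonX n • (n + 2 + u) = n + 1 + u := by
  apply smul_eq_of_comb
  change thompsonGenFun n (comb (n + 2 + u : ℝ≥0)) = comb (n + 1 + u : ℝ≥0)
  obtain ⟨d, hd, hd1, hdn, H⟩ := thompsonGenFun_eq n
  have h1 : comb (n + 2 : ℝ≥0) ≤ comb (n + 2 + u : ℝ≥0) :=
    comb_strictMono.monotone (le_self_add)
  have h2 := comb_natCast_add (n + 2) (le_refl (0 : ℝ)) zero_le_one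
  have h3 := comb_add_int (n + 1 + u : ℝ≥0) 1
  rw [show (((n + 1 + u : ℝ≥0) : ℝ) + (1 : ℤ)) = (n + 2 + u : ℝ≥0) by push_cast; ring] at h3
  have h4 : comb (n + 2 : ℝ≥0) = 1 - d / 4 := by
    rw [add_zero] at h2
    push_cast at h2 ⊢
    rw [h2, hdn, pow_add]
    field_simp
    ring
  rw [h4] at h1
  rw [H]
  rw [zpow_neg_one] at h3
  split_ifs <;> linarith

theorem thompsonX_zero_pow_smul (k : ℕ) (u : ℝ≥0) :
    thompsonX 0 ^ k • (1 + u + k) = 1 + u := by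
  induction k with
  | zero => simp
  | succ k ih =>
    have := thompsonX_smul_add 0 (u + k)
    rw [pow_succ, mul_smul]
    rw [show 1 + u + ((k + 1 : ℕ) : ℝ≥0) = ((0 : ℕ) : ℝ≥0) + 2 + (u + k) by push_cast; ring, this]
    rw [show ((0 : ℕ) : ℝ≥0) + 1 + (u + k) = 1 + u + k by push_cast; ring, ih]

theorem thompsonX_zero_pow_inv_smul (k : ℕ) (u : ℝ≥0) :
    (thompsonX 0 ^ k)⁻¹ • (1 + u) = 1 + u + k := by
  rw [inv_smul_eq_iff, thompsonX_zero_pow_smul]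

theorem thompsonX_zero_pow_smul_le_one {k : ℕ} {s : ℝ≥0} (h : s ≤ 1 + k) :
    thompsonX 0 ^ k • s ≤ 1 := by
  have := thompsonX_zero_pow_smul k 0
  rw [add_zero] at this
  rwa [← this, thompsonF_smul_le_smul_iff]

/-- The element of `F` which doubles `[k, k + 1]` and is a translation to the right of it. -/
noncomputable def splitAt : ℕ → thompsonF
  | 0 => (thompsonX 0)⁻¹
  | k + 1 => (thompsonX 0 ^ k)⁻¹ * (thompsonX 1)⁻¹ * thompsonX 0 ^ k

theorem splitAt_mem_closure (k : ℕ) :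
    splitAt k ∈ Subgroup.closure {thompsonX 0, thompsonX 1} := by
  have h0 : thompsonX 0 ∈ Subgroup.closure {thompsonX 0, thompsonX 1} :=
    Subgroup.subset_closure (by simp)
  have h1 : thompsonX 1 ∈ Subgroup.closure {thompsonX 0, thompsonX 1} :=
    Subgroup.subset_closure (by simp)
  cases k with
  | zero => exact inv_mem h0
  | succ k => exact mul_mem (mul_mem (inv_mem (pow_mem h0 k)) (inv_mem h1)) (pow_mem h0 k)

theorem splitAt_smul_of_le {k : ℕ} {s : ℝ≥0} (h : s ≤ k) : splitAt k • s = s := by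
  cases k with
  | zero =>
    rw [splitAt, inv_smul_eq_iff, thompsonX_smul_of_le 0 h]
  | succ k =>
    rw [splitAt, mul_smul, mul_smul, inv_smul_eq_iff, inv_smul_eq_iff, thompsonX_smul_of_le]
    rw [Nat.cast_one]
    exact thompsonX_zero_pow_smul_le_one (by rw [add_comm]; exact_mod_cast h)

theorem splitAt_smul_double (k : ℕ) {u : ℝ≥0} (h : u ≤ 1) :
    splitAt k • (k + u) = k + 2 * u := by
  cases k with
  | zero =>
    rw [splitAt, inv_smul_eq_iff, thompsonX_smul_double 0 h]
  | succ k =>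
    have e : (((k + 1 : ℕ) : ℝ≥0)) + u = 1 + u + k := by push_cast; ring
    have h1 := thompsonX_smul_double 1 h
    rw [Nat.cast_one] at h1
    rw [splitAt, mul_smul, mul_smul, e, thompsonX_zero_pow_smul, ← h1, inv_smul_smul,
      thompsonX_zero_pow_inv_smul]
    push_cast; ring

theorem splitAt_smul_add (k : ℕ) (u : ℝ≥0) :
    splitAt k • (k + 1 + u) = k + 2 + u := by
  cases k with
  | zero =>
    rw [splitAt, inv_smul_eq_iff, thompsonX_smul_add 0]
  | succ k =>
    have e : (((k + 1 : ℕ) : ℝ≥0)) + 1 + u = 1 + (1 + u) + k := by push_cast; ring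
    have h1 := thompsonX_smul_add 1 u
    rw [Nat.cast_one, show (1 : ℝ≥0) + 1 + u = 1 + (1 + u) by ring] at h1
    rw [splitAt, mul_smul, mul_smul, e, thompsonX_zero_pow_smul, ← h1, inv_smul_smul,
      show (1 : ℝ≥0) + 2 + u = 1 + (2 + u) by ring, thompsonX_zero_pow_inv_smul]
    push_cast; ring

/-- `f` is the identity on `[0, m]`, multiplies lengths by `2 ^ e` on `[m, m + L]`, and is a
translation on `[m + L, ∞)`. -/
structure IsStretch (m L e : ℕ) (f : thompsonF) : Prop where
  of_le : ∀ {s : ℝ≥0}, s ≤ m → f • s = s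
  mid : ∀ {u : ℝ≥0}, u ≤ L → f • (m + u) = m + 2 ^ e * u
  add : ∀ u : ℝ≥0, f • (m + L + u) = m + 2 ^ e * L + u

theorem exists_isStretch_one (m L : ℕ) :
    ∃ f ∈ Subgroup.closure {thompsonX 0, thompsonX 1}, IsStretch m L 1 f := by
  induction L with
  | zero => exact ⟨1, one_mem _, by simp, by simp, by simp⟩
  | succ L ih =>
    obtain ⟨f, hf, h⟩ := ih
    refine ⟨f * splitAt (m + L), mul_mem hf (splitAt_mem_closure _), ?_, ?_, ?_⟩
    · intro s hs
      rw [mul_smul, splitAt_smul_of_le, h.of_le hs]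
      push_cast
      exact hs.trans le_self_add
    · intro u hu
      rw [mul_smul]
      rcases le_total u L with hL | hL
      · rw [splitAt_smul_of_le (by push_cast; gcongr), h.mid hL]
      · obtain ⟨v, rfl⟩ := exists_add_of_le hL
        have hv : v ≤ 1 := by
          push_cast at hu
          exact le_of_add_le_add_left hu
        have := splitAt_smul_double (m + L) hv
        push_cast at this
        rw [← add_assoc, this, h.add]
        ring
    · intro u
      have := splitAt_smul_add (m + L) u
      push_cast at this ⊢
      rw [mul_smul, ← add_assoc, this, add_assoc _ _ u, h.add]
      ring

theorem exists_isStretch (m L e : ℕ) :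
    ∃ f ∈ Subgroup.closure {thompsonX 0, thompsonX 1}, IsStretch m L e f := by
  induction e with
  | zero => exact ⟨1, one_mem _, by simp, by simp, by simp⟩
  | succ e ih =>
    obtain ⟨f, hf, h⟩ := ih
    obtain ⟨f', hf', h'⟩ := exists_isStretch_one m (2 ^ e * L)
    refine ⟨f' * f, mul_mem hf' hf, ?_, ?_, ?_⟩
    · intro s hs
      rw [mul_smul, h.of_le hs, h'.of_le hs]
    · intro u hu
      rw [mul_smul, h.mid hu, h'.mid (by push_cast; gcongr)]
      ring
    · intro u
      have := h'.add u
      push_cast at this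
      rw [mul_smul, h.add, this]
      ring

/-- If `h` stretches each of the intervals `[m, m + 1]`, `m < K`, by a power of `2` and is a
translation to the right of `K`, then it is a product of `x₀^±1` and `x₁^±1`. -/
theorem mem_closure_of_stretches (K : ℕ) : ∀ h : thompsonF,
    (∀ m < K, ∃ e : ℕ, ∀ u : ℝ≥0, u ≤ 1 → h • (m + u) = h • (m : ℝ≥0) + 2 ^ e * u) →
    (∀ u : ℝ≥0, h • (K + u) = h • (K : ℝ≥0) + u) →
    h ∈ Subgroup.closure {thompsonX 0, thompsonX 1} := by
  induction K with
  | zero =>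
    intro h _ h2
    have : h = 1 := by
      refine eq_of_smul_eq fun s => ?_
      simpa [thompsonF_smul_zero] using h2 s
    rw [this]
    exact one_mem _
  | succ K ih =>
    intro h h1 h2
    obtain ⟨e, he⟩ := h1 K (Nat.lt_succ_self K)
    obtain ⟨f, hf, hS⟩ := exists_isStretch K 1 e
    have hS1 : ∀ s : ℝ≥0, s ≤ K → f⁻¹ • s = s := fun s hs => by
      rw [inv_smul_eq_iff, hS.of_le hs]
    suffices h * f⁻¹ ∈ Subgroup.closure {thompsonX 0, thompsonX 1} by
      simpa using mul_mem this hf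
    refine ih _ ?_ ?_
    · intro m hm
      obtain ⟨e', he'⟩ := h1 m (Nat.lt_succ_of_lt hm)
      refine ⟨e', fun u hu => ?_⟩
      have hmK : (m : ℝ≥0) + 1 ≤ K := by exact_mod_cast hm
      rw [mul_smul, mul_smul, hS1 _ ((add_le_add_right hu _).trans hmK),
        hS1 _ (le_self_add.trans hmK), he' u hu]
    · intro u
      rw [mul_smul, mul_smul, hS1 _ le_rfl]
      rcases le_total u (2 ^ e) with hu | hu
      · have hu' : u / 2 ^ e ≤ 1 := by
          rw [div_le_one₀ (by positivity)]; exact hu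
        have e1 : (2 : ℝ≥0) ^ e * (u / 2 ^ e) = u := mul_div_cancel₀ _ (by positivity)
        have e2 : f⁻¹ • ((K : ℝ≥0) + u) = K + u / 2 ^ e := by
          rw [inv_smul_eq_iff, hS.mid (by simpa using hu'), e1]
        rw [e2, he _ hu', e1]
      · obtain ⟨v, rfl⟩ := exists_add_of_le hu
        have e2 : f⁻¹ • ((K : ℝ≥0) + (2 ^ e + v)) = ((K + 1 : ℕ) : ℝ≥0) + v := by
          rw [inv_smul_eq_iff]
          have := hS.add v
          push_cast at this ⊢
          rw [this]
          ring
        rw [e2, h2]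
        push_cast
        rw [he 1 le_rfl]
        ring

/-! ### Germs at `1` -/

/-- In the coordinate on `[0, ∞)`, `H₁` consists of the elements with bounded support. -/
theorem mem_thompsonH1_iff (f : thompsonF) :
    f ∈ thompsonH1 ↔ ∃ N : ℕ, ∀ s : ℝ≥0, N ≤ s → f • s = s := by
  change (1 : unitInterval) ∉ closure (thompsonSupp f) ↔ _
  rw [mem_closure_iff_nhds, not_forall]
  constructor
  · rintro ⟨U, hU⟩
    rw [Classical.not_imp, Set.not_nonempty_iff_eq_empty] at hU
    obtain ⟨hU, hemp⟩ := hU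
    obtain ⟨a, ha, haU⟩ := exists_Ioc_subset_of_mem_nhds hU ⟨0, zero_lt_one⟩
    obtain ⟨s₀, rfl⟩ := exists_combI_eq ha
    obtain ⟨N, hN⟩ := exists_nat_gt s₀
    refine ⟨N, fun s hs => combI_strictMono.injective ?_⟩
    rw [combI_smul]
    by_contra hne
    have : combI s ∈ U ∩ thompsonSupp f :=
      ⟨haU ⟨combI_strictMono (hN.trans_le hs), (combI_lt_one s).le⟩, hne⟩
    rw [hemp] at this
    exact this
  · rintro ⟨N, hN⟩
    refine ⟨Ioi (combI N), ?_⟩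
    rw [Classical.not_imp, Set.not_nonempty_iff_eq_empty]
    refine ⟨Ioi_mem_nhds (combI_lt_one _), ?_⟩
    ext t
    simp only [mem_inter_iff, mem_Ioi, mem_empty_iff_false, iff_false, not_and]
    intro ht htf
    apply htf
    rcases (unitInterval.le_one' (t := t)).lt_or_eq with h1 | rfl
    · obtain ⟨s, rfl⟩ := exists_combI_eq h1
      rw [← combI_smul, hN s (combI_strictMono.lt_iff_lt.1 ht).le]
    · exact f.1.map_top

/-- Near the right end an element of `F` is a translation by an integer. -/
theorem exists_eventually_translation (f : thompsonF) :
    ∃ (k : ℤ) (N : ℕ), ∀ s : ℝ≥0, N ≤ s → ((f • s : ℝ≥0) : ℝ) = s + k := by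
  obtain ⟨S, -, hS⟩ := f.2
  obtain ⟨a, ha1, haS⟩ : ∃ a : ℝ≥0, 0 < a ∧ ∀ s ∈ S, s ∉ Ioo (comb a) 1 := by
    have : ∀ᶠ a : ℝ in 𝓝[<] 1, ∀ s ∈ S, s ∉ Ioo a 1 := by
      rw [Filter.eventually_all_finset]
      intro s _
      rcases lt_or_ge s 1 with h | h
      · filter_upwards [Ioo_mem_nhdsLT h] with a ha hs
        exact lt_asymm ha.1 hs.1
      · filter_upwards with a hs
        exact absurd hs.2 (not_lt.2 h)
    obtain ⟨a, ha, h1⟩ := (this.and (Ioo_mem_nhdsLT (zero_lt_one' ℝ))).exists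
    obtain ⟨s, rfl⟩ := exists_comb_eq h1.1.le h1.2
    refine ⟨s, ?_, ha⟩
    by_contra hs
    have : s = 0 := le_antisymm (not_lt.1 hs) zero_le
    rw [this] at h1
    simp [comb] at h1
  obtain ⟨k, c, hk⟩ := hS (combI a) 1 (combI_lt_one a) haS
  have hk1 := hk 1 ⟨(combI_lt_one a).le, le_rfl⟩
  have hf1 : f.1 1 = 1 := f.1.map_top
  rw [hf1] at hk1
  simp only [Set.Icc.coe_one, mul_one] at hk1
  obtain ⟨N, hN⟩ := exists_nat_gt (max a k.natAbs)
  refine ⟨-k, N, fun s hs => ?_⟩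
  have h1 : a < s := (le_max_left _ _).trans_lt (hN.trans_le hs)
  have h2 : (k.natAbs : ℝ≥0) < s := (le_max_right _ _).trans_lt (hN.trans_le hs)
  have h3 : (k : ℝ) ≤ s := by
    have : ((k.natAbs : ℝ≥0) : ℝ) < s := h2
    rw [NNReal.coe_natCast] at this
    have h4 : (k : ℝ) ≤ k.natAbs := by
      have h5 : k ≤ (k.natAbs : ℤ) := Int.le_natAbs
      calc (k : ℝ) ≤ ((k.natAbs : ℤ) : ℝ) := Int.cast_le.2 h5
        _ = k.natAbs := Int.cast_natCast _
    linarith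
  have h4 : 0 ≤ (s : ℝ) + (-k : ℤ) := by push_cast; linarith
  have : f • s = ((s : ℝ) + (-k : ℤ)).toNNReal := by
    apply smul_eq_of_comb
    rw [Real.coe_toNNReal _ h4, comb_add_int,
      hk (combI s) ⟨(combI_strictMono h1).le, (combI_lt_one s).le⟩, neg_neg]
    simp only [combI]
    linarith
  rw [this, Real.coe_toNNReal _ h4]

instance thompsonH1_normal : thompsonH1.Normal where
  conj_mem h hh f := by
    rw [mem_thompsonH1_iff] at hh ⊢
    obtain ⟨N, hN⟩ := hh
    obtain ⟨M, hM⟩ := exists_nat_ge (f • (N : ℝ≥0))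
    refine ⟨M, fun s hs => ?_⟩
    have : N ≤ f⁻¹ • s := by
      rw [← thompsonF_smul_le_smul_iff f, smul_inv_smul]
      exact hM.trans hs
    rw [mul_smul, mul_smul, hN _ this, smul_inv_smul]

theorem thompsonX_zero_zpow_smul (k : ℤ) :
    ∃ N : ℕ, ∀ s : ℝ≥0, N ≤ s → ((thompsonX 0 ^ k • s : ℝ≥0) : ℝ) = s - k := by
  obtain ⟨j, rfl | rfl⟩ := k.eq_nat_or_neg
  · refine ⟨1 + j, fun s hs => ?_⟩
    obtain ⟨u, rfl⟩ := exists_add_of_le hs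
    rw [zpow_natCast, show (((1 + j : ℕ) : ℝ≥0) + u) = 1 + u + j by push_cast; ring,
      thompsonX_zero_pow_smul]
    push_cast; ring
  · refine ⟨1, fun s hs => ?_⟩
    obtain ⟨u, rfl⟩ := exists_add_of_le hs
    rw [zpow_neg, zpow_natCast, Nat.cast_one, thompsonX_zero_pow_inv_smul]
    push_cast; ring

/-- `F` is generated by `x₀` modulo `H₁`. -/
theorem exists_zpow_mul_mem_thompsonH1 (f : thompsonF) :
    ∃ k : ℤ, (thompsonX 0 ^ k)⁻¹ * f ∈ thompsonH1 := by
  obtain ⟨k, N, hN⟩ := exists_eventually_translation f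
  obtain ⟨M, hM⟩ := thompsonX_zero_zpow_smul (-k)
  refine ⟨-k, ?_⟩
  rw [mem_thompsonH1_iff]
  refine ⟨max N M, fun s hs => ?_⟩
  rw [Nat.cast_max] at hs
  rw [mul_smul, inv_smul_eq_iff]
  apply NNReal.eq
  rw [hN s ((le_max_left _ _).trans hs), hM s ((le_max_right _ _).trans hs)]
  push_cast; ring

/-! ### `x₀` and `x₁` generate `F` -/

theorem comb_eq_on (j : ℕ) : ∃ c : ℝ, IsDyadic c ∧
    ∀ s : ℝ, j ≤ s → s ≤ j + 1 → comb s = 2 ^ (-(j : ℤ) - 1) * s + c := by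
  refine ⟨1 - (2 ^ (-(j : ℤ) - 1) * (j + 2)), ?_, fun s h0 h1 => ?_⟩
  · exact isDyadic_one.sub (IsDyadic.zpow_mul ⟨j + 2, 0, by push_cast; ring⟩ _)
  · obtain ⟨u, rfl⟩ : ∃ u, s = j + u := ⟨s - j, by ring⟩
    rw [comb_natCast_add j (by linarith) (by linarith), zpow_sub₀ two_ne_zero, zpow_neg,
      zpow_natCast]
    field_simp
    ring

theorem isDyadic_comb_iff (s : ℝ≥0) : IsDyadic (comb s) ↔ IsDyadic (s : ℝ) := by
  obtain ⟨j, u, hu, rfl⟩ := exists_nat_add s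
  obtain ⟨c, hc, H⟩ := comb_eq_on j
  have hu' : (u : ℝ) < 1 := hu
  have h := H (j + u : ℝ≥0) (by push_cast; simp) (by push_cast; linarith)
  constructor
  · intro hd
    have := (hd.sub hc).zpow_mul (-(-(j : ℤ) - 1))
    rw [h, add_sub_cancel_right, ← mul_assoc, ← zpow_add₀ two_ne_zero, neg_add_cancel,
      zpow_zero, one_mul] at this
    exact this
  · intro hd
    rw [h]
    exact (hd.zpow_mul _).add hc

/-- A dyadic number becomes an integer after multiplication by large powers of `2`. -/
theorem IsDyadic.eventually_nat {s : ℝ≥0} (h : IsDyadic (s : ℝ)) :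
    ∀ᶠ N : ℕ in atTop, ∃ m : ℕ, 2 ^ N * s = m := by
  obtain ⟨a, n, ha⟩ := h
  have ha0 : 0 ≤ a := by
    have : (0 : ℝ) ≤ a / 2 ^ n := ha ▸ s.coe_nonneg
    rw [div_nonneg_iff] at this
    have h2 : (0 : ℝ) < 2 ^ n := by positivity
    rcases this with h | h
    · exact_mod_cast h.1
    · exact absurd h.2 (not_le.2 h2)
  obtain ⟨a, rfl⟩ := Int.eq_ofNat_of_zero_le ha0
  filter_upwards [eventually_ge_atTop n] with N hN
  obtain ⟨d, rfl⟩ := exists_add_of_le hN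
  refine ⟨2 ^ d * a, ?_⟩
  apply NNReal.eq
  push_cast
  rw [ha, pow_add]
  push_cast
  field_simp

/-- There are no grid points strictly inside a grid interval. -/
theorem grid_notMem_Ioo {N i m : ℕ} {s : ℝ≥0} (h : 2 ^ N * s = m) :
    s ∉ Ioo ((i : ℝ≥0) / 2 ^ N) ((i + 1) / 2 ^ N) := by
  intro hs
  have hp : (0 : ℝ≥0) < 2 ^ N := by positivity
  obtain ⟨h1, h2⟩ := hs
  rw [div_lt_iff₀ hp, mul_comm, h] at h1
  rw [lt_div_iff₀ hp, mul_comm, h] at h2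
  have h1' : i < m := by exact_mod_cast h1
  have h2' : m < i + 1 := by exact_mod_cast h2
  omega

/-- On an interval without integers in its interior `comb` is affine. -/
theorem comb_affine {a b : ℝ≥0} (hab : a < b) (h : ∀ l : ℕ, (l : ℝ≥0) ∉ Ioo a b) :
    ∃ (k : ℤ) (c : ℝ), ∀ s : ℝ≥0, a ≤ s → s ≤ b → comb s = 2 ^ k * (s : ℝ) + c := by
  obtain ⟨j, u, hu, rfl⟩ := exists_nat_add a
  obtain ⟨c, -, H⟩ := comb_eq_on j
  have hb : b ≤ j + 1 := by
    by_contra hb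
    refine h (j + 1) ⟨?_, ?_⟩
    · push_cast
      exact add_lt_add_right hu _
    · push_cast
      exact not_le.1 hb
  refine ⟨_, c, fun s h1 h2 => H s ?_ ?_⟩
  · exact_mod_cast le_self_add.trans h1
  · exact_mod_cast h2.trans hb

/-- Both `comb` and `f` are piecewise affine; the breakpoints of `f` in the new coordinate are the
integers, their preimages, and the breakpoints of `f` on `[0, 1]`. -/
theorem affine_of_breakpoints (f : thompsonF) : ∃ S : Finset ℝ, (∀ s ∈ S, IsDyadic s) ∧
    ∀ a b : ℝ≥0, a < b → (∀ l : ℕ, (l : ℝ≥0) ∉ Ioo a b) →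
      (∀ l : ℕ, (l : ℝ≥0) ∉ Ioo (f • a) (f • b)) → (∀ s ∈ S, s ∉ Ioo (comb a) (comb b)) →
      ∃ (k : ℤ) (c : ℝ), ∀ s : ℝ≥0, a ≤ s → s ≤ b → ((f • s : ℝ≥0) : ℝ) = 2 ^ k * (s : ℝ) + c := by
  obtain ⟨S, hSd, hS⟩ := f.2
  refine ⟨S, hSd, fun a b hab h1 h2 h3 => ?_⟩
  obtain ⟨k, c, hk⟩ := hS (combI a) (combI b) (combI_strictMono hab) h3
  obtain ⟨k₁, c₁, hk₁⟩ := comb_affine hab h1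
  obtain ⟨k₂, c₂, hk₂⟩ := comb_affine ((thompsonF_smul_lt_smul_iff f).2 hab) h2
  refine ⟨k + k₁ - k₂, (2 ^ k * c₁ + c - c₂) / 2 ^ k₂, fun s ha hb => ?_⟩
  have e := hk (combI s) ⟨combI_strictMono.monotone ha, combI_strictMono.monotone hb⟩
  have e1 : ((combI s : unitInterval) : ℝ) = comb s := rfl
  rw [← comb_smul, e1, hk₁ s ha hb,
    hk₂ _ ((thompsonF_smul_le_smul_iff f).2 ha) ((thompsonF_smul_le_smul_iff f).2 hb)] at e
  have hp : (2 : ℝ) ^ k₂ ≠ 0 := by positivity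
  rw [zpow_sub₀ two_ne_zero, zpow_add₀ two_ne_zero]
  field_simp
  linarith

theorem isDyadic_smul_iff (f : thompsonF) (s : ℝ≥0) :
    IsDyadic ((f • s : ℝ≥0) : ℝ) ↔ IsDyadic (s : ℝ) := by
  rw [← isDyadic_comb_iff, comb_smul, ← f.2.isDyadic_iff]
  exact isDyadic_comb_iff s

/-- On `[0, M]` an element of `F` is affine on the intervals of every fine enough dyadic grid. -/
theorem eventually_affine_on_grid (f : thompsonF) (M : ℕ) : ∀ᶠ N : ℕ in atTop,
    ∀ i : ℕ, i < 2 ^ N * M → ∃ (k : ℤ) (c : ℝ), ∀ s : ℝ≥0, (i : ℝ≥0) / 2 ^ N ≤ s →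
      s ≤ (i + 1) / 2 ^ N → ((f • s : ℝ≥0) : ℝ) = 2 ^ k * (s : ℝ) + c := by
  obtain ⟨S, hSd, hS⟩ := affine_of_breakpoints f
  obtain ⟨L, hL⟩ := exists_nat_ge (f • (M : ℝ≥0))
  have h1 : ∀ᶠ N : ℕ in atTop, ∀ t ∈ S, ∀ s : ℝ≥0, comb s = t → ∃ m : ℕ, 2 ^ N * s = m := by
    rw [Filter.eventually_all_finset]
    intro t ht
    by_cases h : ∃ s : ℝ≥0, comb s = t
    · obtain ⟨s, rfl⟩ := h
      filter_upwards [((isDyadic_comb_iff s).1 (hSd _ ht)).eventually_nat] with N hN s' hs'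
      rwa [comb_strictMono.injective hs']
    · exact Eventually.of_forall fun N s hs => absurd ⟨s, hs⟩ h
  have h2 : ∀ᶠ N : ℕ in atTop, ∀ l ∈ Finset.range L, ∃ m : ℕ,
      2 ^ N * (f⁻¹ • (l : ℝ≥0)) = m := by
    rw [Filter.eventually_all_finset]
    intro l _
    apply IsDyadic.eventually_nat
    rw [isDyadic_smul_iff]
    exact ⟨l, 0, by simp⟩
  filter_upwards [h1, h2] with N h1 h2 i hi
  have hp : (0 : ℝ≥0) < 2 ^ N := by positivity
  have hlt : (i : ℝ≥0) / 2 ^ N < (i + 1) / 2 ^ N := by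
    gcongr
    exact lt_add_one _
  have hM : ((i : ℝ≥0) + 1) / 2 ^ N ≤ M := by
    rw [div_le_iff₀ hp, mul_comm]
    exact_mod_cast hi
  refine hS _ _ hlt ?_ ?_ ?_
  · intro l
    exact grid_notMem_Ioo (m := 2 ^ N * l) (by push_cast; rfl)
  · intro l hl
    have hlL : l < L := by
      have := hl.2.trans_le (((thompsonF_smul_le_smul_iff f).2 hM).trans hL)
      exact_mod_cast this
    obtain ⟨m, hm⟩ := h2 l (Finset.mem_range.2 hlL)
    refine grid_notMem_Ioo (i := i) hm ⟨?_, ?_⟩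
    · rw [← thompsonF_smul_lt_smul_iff f, smul_inv_smul]; exact hl.1
    · rw [← thompsonF_smul_lt_smul_iff f, smul_inv_smul]; exact hl.2
  · intro t ht hmem
    obtain ⟨s, rfl⟩ := exists_comb_eq ((comb_nonneg _).trans hmem.1.le)
      (hmem.2.trans (comb_lt_one _))
    obtain ⟨m, hm⟩ := h1 _ ht s rfl
    exact grid_notMem_Ioo (i := i) hm ⟨comb_strictMono.lt_iff_lt.1 hmem.1,
      comb_strictMono.lt_iff_lt.1 hmem.2⟩

/-- Thompson's group `F` is generated by `x₀` and `x₁`. -/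
theorem closure_thompsonX_eq_top :
    Subgroup.closure {thompsonX 0, thompsonX 1} = ⊤ := by
  rw [eq_top_iff]
  intro f _
  obtain ⟨k₀, M₀, hM₀⟩ := exists_eventually_translation f
  obtain ⟨M, M', hMM', hM⟩ : ∃ M M' : ℕ, f • (M : ℝ≥0) = M' ∧
      ∀ u : ℝ≥0, f • ((M : ℝ≥0) + u) = M' + u := by
    have h := hM₀ M₀ le_rfl
    have h0 : 0 ≤ (M₀ : ℤ) + k₀ := by
      have : (0 : ℝ) ≤ (f • (M₀ : ℝ≥0) : ℝ≥0) := NNReal.coe_nonneg _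
      rw [h, NNReal.coe_natCast] at this
      exact_mod_cast this
    obtain ⟨M', hM'⟩ := Int.eq_ofNat_of_zero_le h0
    have hM'R : ((M₀ : ℝ) + k₀) = M' := by exact_mod_cast hM'
    refine ⟨M₀, M', ?_, fun u => ?_⟩
    · apply NNReal.eq
      rw [h, NNReal.coe_natCast, NNReal.coe_natCast, hM'R]
    · apply NNReal.eq
      rw [hM₀ _ le_self_add]
      push_cast
      linarith
  obtain ⟨N, hN⟩ := (eventually_affine_on_grid f M).exists
  choose! k c hkc using hN
  -- `P` and `P'` magnify by `2 ^ N` and `2 ^ N'`; for large `N'` the product `P' f P⁻¹` contracts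
  -- nothing.
  obtain ⟨N', hN'⟩ : ∃ N' : ℕ, ∀ i < 2 ^ N * M, (N : ℤ) ≤ N' + k i := by
    obtain ⟨B, hB⟩ := ((Finset.range (2 ^ N * M)).image fun i => ((N : ℤ) - k i).toNat).exists_le
    refine ⟨B, fun i hi => ?_⟩
    have := hB _ (Finset.mem_image_of_mem _ (Finset.mem_range.2 hi))
    omega
  obtain ⟨P, hP, hPS⟩ := exists_isStretch 0 M N
  obtain ⟨P', hP', hPS'⟩ := exists_isStretch 0 M' N'
  suffices P' * f * P⁻¹ ∈ Subgroup.closure {thompsonX 0, thompsonX 1} by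
    have := mul_mem (mul_mem (inv_mem hP') this) hP
    simpa [mul_assoc] using this
  have hp : (0 : ℝ≥0) < 2 ^ N := by positivity
  have hPinv : ∀ s : ℝ≥0, s ≤ 2 ^ N * M → P⁻¹ • s = s / 2 ^ N := by
    intro s hs
    have := hPS.mid (u := s / 2 ^ N) (by rw [div_le_iff₀ hp, mul_comm]; exact hs)
    rw [inv_smul_eq_iff]
    rw [Nat.cast_zero, zero_add, zero_add, mul_div_cancel₀ _ hp.ne'] at this
    exact this.symm
  have hval : ∀ s : ℝ≥0, s ≤ 2 ^ N * M →
      (P' * f * P⁻¹) • s = 2 ^ N' * (f • (s / 2 ^ N)) := by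
    intro s hs
    have h1 : f • (s / 2 ^ N) ≤ (M' : ℝ≥0) := by
      rw [← hMM', thompsonF_smul_le_smul_iff, div_le_iff₀ hp, mul_comm]
      exact hs
    have := hPS'.mid h1
    rw [Nat.cast_zero, zero_add, zero_add] at this
    rw [mul_smul, mul_smul, hPinv s hs, this]
  refine mem_closure_of_stretches (2 ^ N * M) _ ?_ ?_
  · intro m hm
    obtain ⟨e, he⟩ := Int.eq_ofNat_of_zero_le (sub_nonneg.2 (hN' m hm))
    have hmM : (m : ℝ≥0) + 1 ≤ 2 ^ N * M := by exact_mod_cast hm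
    refine ⟨e, fun u hu => ?_⟩
    rw [hval _ ((add_le_add_right hu _).trans hmM), hval _ (le_self_add.trans hmM)]
    apply NNReal.eq
    have e1 := hkc m hm (((m : ℝ≥0) + u) / 2 ^ N) (by gcongr; exact le_self_add) (by gcongr)
    have e2 := hkc m hm ((m : ℝ≥0) / 2 ^ N) le_rfl (by gcongr; exact le_self_add)
    push_cast
    rw [e1, e2]
    have e3 : (2 : ℝ) ^ e = 2 ^ N' * 2 ^ k m / 2 ^ N := by
      rw [← zpow_natCast 2 e, ← zpow_natCast 2 N', ← zpow_natCast 2 N, ← zpow_add₀ two_ne_zero,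
        ← zpow_sub₀ two_ne_zero, he]
    rw [e3]
    push_cast
    ring
  · intro u
    have e1 : P⁻¹ • ((2 : ℝ≥0) ^ N * M + u) = M + u := by
      rw [inv_smul_eq_iff]
      have := hPS.add u
      simpa using this.symm
    have e2 := hPS'.add u
    rw [Nat.cast_zero, zero_add, zero_add] at e2
    push_cast
    rw [hval _ le_rfl, mul_smul, mul_smul, e1, hM, e2, mul_div_cancel_left₀ _ hp.ne', hMM']

/-! ### `F` satisfies no law -/

/-- `F` contains integral interpolations: the beginning of a strictly increasing sequence of natural
numbers with first term `1` is the image of `1, 2, …, m + 1` under some element of `F` which is the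
identity on `[0, 1]` and a translation on `[m + 1, ∞)`. -/
theorem exists_interpolation {a : ℕ → ℕ} (ha : StrictMono a) (ha0 : a 0 = 1) (m : ℕ) :
    ∃ A : thompsonF, (∀ s : ℝ≥0, s ≤ 1 → A • s = s) ∧
      (∀ j ≤ m, A • ((j + 1 : ℕ) : ℝ≥0) = a j) ∧
      ∀ u : ℝ≥0, A • (((m + 1 : ℕ) : ℝ≥0) + u) = a m + u := by
  induction m with
  | zero => exact ⟨1, by simp, by simp [ha0], by simp [ha0]⟩
  | succ m ih =>
    obtain ⟨A, h1, h2, h3⟩ := ih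
    obtain ⟨d, hd⟩ : ∃ d, a (m + 1) = a m + 1 + d := by
      obtain ⟨d, hd⟩ := exists_add_of_le (Nat.succ_le_of_lt (ha (Nat.lt_succ_self m)))
      exact ⟨d, hd⟩
    have hfix : ∀ s : ℝ≥0, s ≤ (m + 1 : ℕ) → splitAt (m + 1) ^ d • s = s := fun s hs =>
      pow_mem (S := MulAction.stabilizer thompsonF s) (splitAt_smul_of_le hs) d
    have hadd : ∀ (d : ℕ) (u : ℝ≥0), splitAt (m + 1) ^ d • ((m + 1 : ℕ) + 1 + u : ℝ≥0) =
        (m + 1 : ℕ) + 1 + d + u := by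
      intro d
      induction d with
      | zero => simp
      | succ d ih =>
        intro u
        have := splitAt_smul_add (m + 1) u
        rw [pow_succ, mul_smul, this, show ((m + 1 : ℕ) + 2 + u : ℝ≥0) =
          (m + 1 : ℕ) + 1 + (1 + u) by ring, ih]
        push_cast; ring
    refine ⟨A * splitAt (m + 1) ^ d, ?_, ?_, ?_⟩
    · intro s hs
      rw [mul_smul, hfix, h1 s hs]
      exact hs.trans (by push_cast; exact le_add_self)
    · intro j hj
      rcases Nat.lt_or_ge j (m + 1) with hj' | hj'
      · rw [mul_smul, hfix, h2 j (Nat.lt_succ_iff.1 hj')]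
        exact_mod_cast hj'
      · obtain rfl : j = m + 1 := le_antisymm hj hj'
        have := hadd d 0
        rw [add_zero, add_zero] at this
        rw [mul_smul, Nat.cast_succ (m + 1), this, add_assoc _ _ (d : ℝ≥0), h3, hd]
        push_cast; ring
    · intro u
      rw [mul_smul, Nat.cast_succ (m + 1), hadd, add_assoc _ _ (d : ℝ≥0), add_assoc, h3, hd]
      push_cast; ring

/-- Letters are pairs `(x, true)` for `x` and `(x, false)` for `x⁻¹`. For a sequence of letters with
gaps in which no letter is followed by its inverse there are elements of `F` such that the `j`-th
letter sends `2 (j + 1) + 2` to `2 j + 2`, for all `j`. -/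
theorem exists_trajectory {α : Type*} [DecidableEq α] (l : ℕ → Option (α × Bool))
    (hred : ∀ j x b, l j = some (x, b) → l (j + 1) ≠ some (x, !b)) (m : ℕ)
    (hm : ∀ j, m ≤ j → l j = none) :
    ∃ f : α → thompsonF, (∀ x, ∀ s : ℝ≥0, s ≤ 1 → f x • s = s) ∧
      (∀ x, ∀ s : ℝ≥0, (2 * m + 3 : ℕ) ≤ s → f x • s = s) ∧
      ∀ j x b, l j = some (x, b) →
        (bif b then f x else (f x)⁻¹) • ((2 * (j + 1) + 2 : ℕ) : ℝ≥0) = (2 * j + 2 : ℕ) := by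
  -- `a x` lists the points where the value of `f x` is prescribed, `b x` the values; a position
  -- without the letter `x` contributes a fixed point.
  let a : α → ℕ → ℕ := fun x j => match j with
    | 0 => 1
    | j + 1 => 2 * j + 2 +
      if l j = some (x, true) then 2 else if l j = some (x, false) then 0 else 1
  let b : α → ℕ → ℕ := fun x j => match j with
    | 0 => 1
    | j + 1 => 2 * j + 2 +
      if l j = some (x, true) then 0 else if l j = some (x, false) then 2 else 1
  have ha : ∀ x, StrictMono (a x) := by
    intro x
    refine strictMono_nat_of_lt_succ fun j => ?_
    cases j with
    | zero => simp only [a]; omega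
    | succ j =>
      have h1 := hred j x true
      have h2 := hred j x false
      simp only [a]
      split_ifs <;> simp_all <;> omega
  have hb : ∀ x, StrictMono (b x) := by
    intro x
    refine strictMono_nat_of_lt_succ fun j => ?_
    cases j with
    | zero => simp only [b]; omega
    | succ j =>
      have h1 := hred j x true
      have h2 := hred j x false
      simp only [b]
      split_ifs <;> simp_all <;> omega
  choose A hA1 hA2 hA3 using fun x => exists_interpolation (ha x) rfl (m + 1)
  choose B hB1 hB2 hB3 using fun x => exists_interpolation (hb x) rfl (m + 1)
  have hAi : ∀ x, ∀ s : ℝ≥0, s ≤ 1 → (A x)⁻¹ • s = s := fun x s hs => by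
    rw [inv_smul_eq_iff, hA1 x s hs]
  have key : ∀ x, ∀ j ≤ m + 1, (B x * (A x)⁻¹) • (a x j : ℝ≥0) = b x j := by
    intro x j hj
    rw [mul_smul, ← hA2 x j hj, inv_smul_smul, hB2 x j hj]
  refine ⟨fun x => B x * (A x)⁻¹, ?_, ?_, ?_⟩
  · intro x s hs
    rw [mul_smul, hAi x s hs, hB1 x s hs]
  · intro x s hs
    have e1 : a x (m + 1) = 2 * m + 3 := by simp [a, hm m le_rfl]
    have e2 : b x (m + 1) = 2 * m + 3 := by simp [b, hm m le_rfl]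
    obtain ⟨u, rfl⟩ := exists_add_of_le hs
    have h1 := hA3 x u
    have h2 := hB3 x u
    rw [e1] at h1
    rw [e2] at h2
    rw [mul_smul, inv_smul_eq_iff.2 h1.symm, h2]
  · intro j x c hc
    have hj : j + 1 ≤ m + 1 := by
      by_contra hcon
      rw [hm j (by omega)] at hc
      simp at hc
    have h := key x (j + 1) hj
    cases c with
    | true =>
      rw [cond_true]
      convert h using 2 <;> simp [a, b, hc, mul_add]
    | false =>
      rw [cond_false, inv_smul_eq_iff, eq_comm]
      convert h using 2 <;> simp [a, b, hc, mul_add]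

/-- Finitely many nontrivial words can be kept nontrivial under one substitution of elements of `F`
with support in `[1, 2]`. -/
theorem exists_substitution {α : Type*} [DecidableEq α] (v : ℕ → FreeGroup α) (n : ℕ) :
    ∃ f : α → thompsonF, (∀ x, ∀ s : ℝ≥0, s ≤ 1 → f x • s = s) ∧
      (∀ x, ∀ s : ℝ≥0, 2 ≤ s → f x • s = s) ∧
      ∀ k ≤ n, v k ≠ 1 → FreeGroup.lift f (v k) ≠ 1 := by
  obtain ⟨W, hW⟩ := ((Finset.range (n + 1)).image fun k => (v k).toWord.length + 1).exists_le
  replace hW : ∀ k ≤ n, (v k).toWord.length < W := fun k hk =>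
    hW _ (Finset.mem_image_of_mem _ (Finset.mem_range.2 (Nat.lt_succ_of_le hk)))
  have hW0 : 0 < W := (Nat.zero_le _).trans_lt (hW 0 (Nat.zero_le _))
  -- The letters of `v 0, …, v n`, each word padded by gaps to length `W`.
  let l : ℕ → Option (α × Bool) := fun j =>
    if j / W ≤ n then (v (j / W)).toWord[j % W]? else none
  obtain ⟨f, hf1, hf2, hf3⟩ := exists_trajectory l (by
      intro j x b h1 h2
      simp only [l] at h1 h2
      split_ifs at h1 h2 with c1 c2
      obtain ⟨i1, e1⟩ := List.getElem?_eq_some_iff.1 h1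
      obtain ⟨i2, e2⟩ := List.getElem?_eq_some_iff.1 h2
      have hlt := hW _ c1
      have hmod : (j + 1) / W = j / W ∧ (j + 1) % W = j % W + 1 := by
        rw [Nat.div_mod_unique hW0]
        have := Nat.mod_add_div j W
        omega
      have hr := FreeGroup.isReduced_toWord (x := v (j / W))
      rw [FreeGroup.IsReduced, List.isChain_iff_getElem] at hr
      simp only [hmod] at i2 e2
      have := hr (j % W) i2
      rw [e1, e2] at this
      simp at this) ((n + 1) * W) (by
      intro j hj
      have : ¬ j / W ≤ n := by
        have := (Nat.le_div_iff_mul_le hW0).2 hj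
        omega
      simp only [l, if_neg this])
  have traj : ∀ (L : List (α × Bool)) (j : ℕ),
      (∀ i (h : i < L.length), l (j + i) = some L[i]) →
      FreeGroup.lift f (FreeGroup.mk L) • ((2 * (j + L.length) + 2 : ℕ) : ℝ≥0) =
        (2 * j + 2 : ℕ) := by
    intro L
    induction L with
    | nil => intro j _; simp
    | cons p L ih =>
      intro j h
      have h1 := ih (j + 1) fun i hi => by
        have := h (i + 1) (by simpa using hi)
        rw [add_assoc, add_comm 1 i, this]
        simp
      have h2 := hf3 j p.1 p.2 (h 0 (by simp))
      rw [FreeGroup.lift_mk] at h1 ⊢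
      rw [List.map_cons, List.prod_cons, mul_smul, List.length_cons,
        show j + (L.length + 1) = j + 1 + L.length by ring, h1]
      exact h2
  -- Conjugation by `C⁻¹` squeezes the common support of the `f x` into `[1, 2]`.
  obtain ⟨C, -, hC⟩ := exists_isStretch 1 1 (2 * ((n + 1) * W) + 3)
  have hbig : ((2 * ((n + 1) * W) + 3 : ℕ) : ℝ≥0) ≤
      1 + 2 ^ (2 * ((n + 1) * W) + 3) := by
    have := (Nat.lt_two_pow_self (n := 2 * ((n + 1) * W) + 3)).le
    have h2 : ((2 * ((n + 1) * W) + 3 : ℕ) : ℝ≥0) ≤ 2 ^ (2 * ((n + 1) * W) + 3) := by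
      exact_mod_cast this
    exact h2.trans le_add_self
  refine ⟨fun x => MulAut.conj C⁻¹ (f x), ?_, ?_, ?_⟩
  · intro x s hs
    have h1 : C • s = s := hC.of_le (by simpa using hs)
    change (C⁻¹ * f x * C⁻¹⁻¹) • s = s
    rw [inv_inv, mul_smul, mul_smul, h1, hf1 x s hs, inv_smul_eq_iff, h1]
  · intro x s hs
    change (C⁻¹ * f x * C⁻¹⁻¹) • s = s
    rw [inv_inv, mul_smul, mul_smul, hf2, inv_smul_smul]
    obtain ⟨u, rfl⟩ := exists_add_of_le hs
    have := hC.add u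
    rw [Nat.cast_one, mul_one, one_add_one_eq_two] at this
    rw [this]
    exact hbig.trans le_self_add
  · intro k hk hv h1
    have hcomp : FreeGroup.lift (fun x => MulAut.conj C⁻¹ (f x)) (v k) =
        MulAut.conj C⁻¹ (FreeGroup.lift f (v k)) := by
      refine DFunLike.congr_fun (?_ : _ = (MulAut.conj C⁻¹).toMonoidHom.comp (FreeGroup.lift f)) _
      ext x
      simp
    rw [hcomp, map_eq_one_iff _ (MulAut.conj C⁻¹).injective] at h1
    have := traj (v k).toWord (W * k) (by
      intro i hi
      have hiW := hi.trans (hW k hk)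
      have e1 : (W * k + i) / W = k := by
        rw [Nat.mul_add_div hW0, Nat.div_eq_of_lt hiW, add_zero]
      have e2 : (W * k + i) % W = i := by
        rw [Nat.mul_add_mod, Nat.mod_eq_of_lt hiW]
      simp only [l, e1, e2, if_pos hk]
      exact List.getElem?_eq_getElem hi)
    rw [FreeGroup.mk_toWord, h1, one_smul] at this
    have hlen : (v k).toWord.length = 0 := by
      have : 2 * (W * k + (v k).toWord.length) + 2 = 2 * (W * k) + 2 := by exact_mod_cast this
      omega
    rw [List.length_eq_zero_iff, FreeGroup.toWord_eq_nil_iff] at hlen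
    exact hv hlen

/-! ### Words in the conjugates by powers of `x₀` -/

/-- The homomorphism from the free group on `ℤ` with `i ↦ xⁱ t x⁻ⁱ`. -/
def conjWord {G : Type*} [Group G] (x t : G) : FreeGroup ℤ →* G :=
  FreeGroup.lift fun i => x ^ i * t * (x ^ i)⁻¹

theorem conjWord_of {G : Type*} [Group G] (x t : G) (i : ℤ) :
    conjWord x t (FreeGroup.of i) = x ^ i * t * (x ^ i)⁻¹ := FreeGroup.lift_apply_of

theorem map_conjWord {G G' : Type*} [Group G] [Group G'] (φ : G →* G') (x t : G)
    (u : FreeGroup ℤ) : φ (conjWord x t u) = conjWord (φ x) (φ t) u := by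
  refine DFunLike.congr_fun (?_ : φ.comp (conjWord x t) = conjWord (φ x) (φ t)) u
  ext i
  simp [conjWord]

theorem conjWord_mem {G : Type*} [Group G] {N : Subgroup G} [N.Normal] (x : G) {t : G}
    (ht : t ∈ N) (u : FreeGroup ℤ) : conjWord x t u ∈ N := by
  have : (conjWord x t).range ≤ N := by
    apply FreeGroup.range_lift_le
    rintro _ ⟨i, rfl⟩
    exact ‹N.Normal›.conj_mem t ht (x ^ i)
  exact this ⟨u, rfl⟩

theorem lift_smul_eq_self {G α X : Type*} [Group G] [MulAction G X] {f : α → G} {t : X}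
    (h : ∀ x, f x • t = t) (w : FreeGroup α) : FreeGroup.lift f w • t = t := by
  have : (FreeGroup.lift f).range ≤ MulAction.stabilizer G t := by
    apply FreeGroup.range_lift_le
    rintro _ ⟨i, rfl⟩
    exact h i
  exact this ⟨w, rfl⟩

/-- Elements of `F` with support in `[1, 2]` can be put side by side: some `g` acts on
`[J + k + 1, J + k + 2]` as `p k` does on `[1, 2]`, for all `k < K`, and is the identity
elsewhere. -/
theorem exists_juxtaposition (p : ℕ → thompsonF) (h1 : ∀ k, ∀ s : ℝ≥0, s ≤ 1 → p k • s = s)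
    (h2 : ∀ k, ∀ s : ℝ≥0, 2 ≤ s → p k • s = s) (J K : ℕ) :
    ∃ g : thompsonF, (∀ s : ℝ≥0, s ≤ J + 1 → g • s = s) ∧
      (∀ s : ℝ≥0, J + K + 1 ≤ s → g • s = s) ∧
      ∀ k < K, ∀ s : ℝ≥0, 1 ≤ s → s ≤ 2 → g • (s + J + k) = p k • s + J + k := by
  induction K with
  | zero => exact ⟨1, by simp, by simp, by simp⟩
  | succ K ih =>
    obtain ⟨g, hg1, hg2, hg3⟩ := ih
    let y : thompsonF := (thompsonX 0 ^ (J + K))⁻¹ * p K * thompsonX 0 ^ (J + K)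
    have hy1 : ∀ s : ℝ≥0, s ≤ J + K + 1 → y • s = s := by
      intro s hs
      rw [mul_smul, mul_smul, h1 K, inv_smul_smul]
      apply thompsonX_zero_pow_smul_le_one
      push_cast
      rwa [add_comm]
    have hy2 : ∀ s : ℝ≥0, 1 ≤ s → y • (s + J + K) = p K • s + J + K := by
      intro s hs
      obtain ⟨u, rfl⟩ := exists_add_of_le hs
      have hp : 1 ≤ p K • (1 + u) := by
        have := (thompsonF_smul_le_smul_iff (p K)).2 hs
        rwa [h1 K 1 le_rfl] at this
      obtain ⟨w, hw⟩ := exists_add_of_le hp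
      have e := thompsonX_zero_pow_smul (J + K) u
      have e' := thompsonX_zero_pow_inv_smul (J + K) w
      push_cast at e e'
      rw [mul_smul, mul_smul, add_assoc, e, hw, e', add_assoc _ (J : ℝ≥0)]
    refine ⟨g * y, ?_, ?_, ?_⟩
    · intro s hs
      rw [mul_smul, hy1, hg1 s hs]
      exact hs.trans (by gcongr; exact le_self_add)
    · intro s hs
      obtain ⟨u, rfl⟩ := exists_add_of_le hs
      have := hy2 (2 + u) (one_le_two.trans le_self_add)
      rw [h2 K _ le_self_add, show (2 : ℝ≥0) + u + J + K = J + (K + 1 : ℕ) + 1 + u by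
        push_cast; ring] at this
      rw [mul_smul, this, hg2]
      refine le_trans ?_ hs
      push_cast
      gcongr
      exact le_self_add
    · intro k hk s hs1 hs2
      rcases Nat.lt_succ_iff_lt_or_eq.1 hk with hk | rfl
      · have hk' : (k : ℝ≥0) + 1 ≤ K := by exact_mod_cast hk
        rw [mul_smul, hy1, hg3 k hk s hs1 hs2]
        calc s + J + k ≤ 2 + J + k := by gcongr
          _ = J + (k + 1) + 1 := by ring
          _ ≤ J + K + 1 := by gcongr
      · rw [mul_smul, hy2 s hs1, hg2]
        have hp : 1 ≤ p k • s := by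
          rw [← h1 k 1 le_rfl, thompsonF_smul_le_smul_iff]
          exact hs1
        calc (J : ℝ≥0) + k + 1 = 1 + J + k := by ring
          _ ≤ _ := by gcongr

/-- If the conjugates `xⁱ g x⁻ⁱ` with small `|i|` act on `[J + 1, J + 2]` as `f i` does on `[1, 2]`,
then a given word in these conjugates acts there as the corresponding word in the `f i`. -/
theorem exists_window (f : ℤ → thompsonF) (h1 : ∀ x, ∀ s : ℝ≥0, s ≤ 1 → f x • s = s)
    (h2 : ∀ x, ∀ s : ℝ≥0, 2 ≤ s → f x • s = s) (u : FreeGroup ℤ) :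
    ∃ r : ℕ, ∀ (g x : thompsonF) (J : ℝ≥0),
      (∀ i : ℤ, |i| ≤ r → ∀ s : ℝ≥0, 1 ≤ s → s ≤ 2 →
        (x ^ i * g * (x ^ i)⁻¹) • (s + J) = f i • s + J) →
      ∀ s : ℝ≥0, 1 ≤ s → s ≤ 2 → conjWord x g u • (s + J) = FreeGroup.lift f u • s + J := by
  -- The `f i` preserve `[1, 2]`, so partial words never leave `[J + 1, J + 2]`.
  have hpres : ∀ (w : FreeGroup ℤ) (s : ℝ≥0), 1 ≤ s → s ≤ 2 →
      1 ≤ FreeGroup.lift f w • s ∧ FreeGroup.lift f w • s ≤ 2 := by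
    intro w s hs1 hs2
    constructor
    · rw [← lift_smul_eq_self (fun x => h1 x 1 le_rfl) w, thompsonF_smul_le_smul_iff]
      exact hs1
    · rw [← lift_smul_eq_self (fun x => h2 x 2 le_rfl) w, thompsonF_smul_le_smul_iff]
      exact hs2
  induction u using FreeGroup.induction_on with
  | C1 => exact ⟨0, by simp⟩
  | of i =>
    refine ⟨i.natAbs, fun g x J H s hs1 hs2 => ?_⟩
    rw [conjWord_of, FreeGroup.lift_apply_of, H i (by simp) s hs1 hs2]
  | inv_of i ih =>
    obtain ⟨r, hr⟩ := ih
    refine ⟨r, fun g x J H s hs1 hs2 => ?_⟩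
    obtain ⟨e1, e2⟩ := hpres (FreeGroup.of i)⁻¹ s hs1 hs2
    rw [map_inv, inv_smul_eq_iff, hr g x J H _ e1 e2, map_inv, smul_inv_smul]
  | mul u v hu hv =>
    obtain ⟨r, hr⟩ := hu
    obtain ⟨r', hr'⟩ := hv
    refine ⟨max r r', fun g x J H s hs1 hs2 => ?_⟩
    obtain ⟨e1, e2⟩ := hpres v s hs1 hs2
    rw [map_mul, mul_smul, hr' g x J (fun i hi => H i (hi.trans (by simp))) s hs1 hs2,
      hr g x J (fun i hi => H i (hi.trans (by simp))) _ e1 e2, map_mul, mul_smul]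

/-- For finitely many nontrivial words in the conjugates `x₀ⁱ g x₀⁻ⁱ` there is an element `g ∈ H₁`
with support near the right end such that all of them move points near the right end. -/
theorem exists_moving (v : ℕ → FreeGroup ℤ) (n : ℕ) :
    ∃ g ∈ thompsonH1, (∀ s : ℝ≥0, s ≤ n → g • s = s) ∧
      ∀ k ≤ n, v k ≠ 1 → ∃ s : ℝ≥0, n ≤ s ∧ conjWord (thompsonX 0) g (v k) • s ≠ s := by
  obtain ⟨f, hf1, hf2, hf3⟩ := exists_substitution v n
  choose R hR using exists_window f hf1 hf2
  obtain ⟨r, hr⟩ := ((Finset.range (n + 1)).image fun k => R (v k)).exists_le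
  replace hr : ∀ k ≤ n, R (v k) ≤ r := fun k hk =>
    hr _ (Finset.mem_image_of_mem _ (Finset.mem_range.2 (Nat.lt_succ_of_le hk)))
  obtain ⟨g, hg1, hg2, hg3⟩ := exists_juxtaposition (fun k => f (k - r)) (fun k => hf1 _)
    (fun k => hf2 _) n (2 * r + 1)
  have hpos : ∀ i, ∀ s : ℝ≥0, 1 ≤ s → 1 ≤ f i • s := fun i s hs => by
    rw [← hf1 i 1 le_rfl, thompsonF_smul_le_smul_iff]
    exact hs
  have hshift : ∀ (k : ℕ) (s : ℝ≥0), 1 ≤ s →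
      (thompsonX 0 ^ ((k : ℤ) - r))⁻¹ • (s + (n + r)) = s + n + k := by
    intro k s hs
    obtain ⟨u, rfl⟩ := exists_add_of_le hs
    have e1 := thompsonX_zero_pow_smul r (u + n)
    have e2 := thompsonX_zero_pow_inv_smul k (u + n)
    rw [zpow_sub, mul_inv_rev, inv_inv, zpow_natCast, zpow_natCast,
      ← (Commute.pow_pow_self (thompsonX 0) r k).inv_right.eq.symm, mul_smul,
      show 1 + u + (n + (r : ℝ≥0)) = 1 + (u + n) + r by ring, e1, e2]
    ring
  refine ⟨g, (mem_thompsonH1_iff g).2 ⟨n + (2 * r + 1) + 1, fun s hs => hg2 s ?_⟩,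
    fun s hs => hg1 s (hs.trans le_self_add), fun k hk hv => ?_⟩
  · exact_mod_cast hs
  · have hne : ∃ s : ℝ≥0, FreeGroup.lift f (v k) • s ≠ s := by
      by_contra! hcon
      exact hf3 k hk hv (eq_of_smul_eq fun s => by rw [hcon, one_smul])
    obtain ⟨s, hs⟩ := hne
    have key : ¬ ∀ x, f x • s = s := fun ht => hs (lift_smul_eq_self ht (v k))
    have hs1 : 1 ≤ s := le_of_not_ge fun h => key fun x => hf1 x s h
    have hs2 : s ≤ 2 := le_of_not_ge fun h => key fun x => hf2 x s h
    refine ⟨s + (n + r), le_add_of_le_right le_self_add, ?_⟩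
    rw [hR (v k) g (thompsonX 0) (n + r) ?_ s hs1 hs2]
    · simpa using hs
    · intro i hi s hs1 hs2
      obtain ⟨hi1, hi2⟩ := abs_le.1 hi
      have hrr := hr k hk
      obtain ⟨j, hj⟩ := Int.eq_ofNat_of_zero_le (show 0 ≤ i + r by omega)
      obtain rfl : i = j - r := by omega
      have := hg3 j (by omega) s hs1 hs2
      rw [mul_smul, mul_smul, hshift j s hs1, this, ← hshift j _ (hpos _ s hs1), smul_inv_smul]

/-- An element of `H₁` commutes with all elements of `F` that are supported near the right end. -/
theorem eventually_commute {g : ℕ → thompsonF} (hg : ∀ (n : ℕ) (s : ℝ≥0), s ≤ n → g n • s = s)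
    {h : thompsonF} (hh : h ∈ thompsonH1) : ∀ᶠ n in atTop, g n * h = h * g n := by
  obtain ⟨N, hN⟩ := (mem_thompsonH1_iff h).1 hh
  filter_upwards [eventually_ge_atTop N] with n hn
  have hn' : (N : ℝ≥0) ≤ n := by exact_mod_cast hn
  refine eq_of_smul_eq fun s => ?_
  rw [mul_smul, mul_smul]
  rcases le_total s n with hs | hs
  · rw [hg n s hs, hg n]
    rw [← hN n hn', thompsonF_smul_le_smul_iff]
    exact hs
  · have : (n : ℝ≥0) ≤ g n • s := by
      rw [← hg n (n : ℝ≥0) le_rfl, thompsonF_smul_le_smul_iff]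
      exact hs
    rw [hN s (hn'.trans hs), hN _ (hn'.trans this)]

/-! ### The HNN-extension as a limit -/

/-- The centralized HNN-extension of `F` over `H₁`. -/
abbrev ThompsonHNN : Type := CentralizedHNN thompsonF thompsonH1

/-- A sequence of marked groups converges if every word is eventually a relation of its members if
and only if it is a relation of the limit. -/
theorem MarkedGroupSpace.tendsto_mk {n : ℕ} {G L : Type} [Group G] [Group L]
    {s : ℕ → Fin n → G} {t : Fin n → L} (hs : ∀ k, Subgroup.closure (Set.range (s k)) = ⊤)
    (ht : Subgroup.closure (Set.range t) = ⊤)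
    (h : ∀ w, ∀ᶠ k in atTop, (FreeGroup.lift (s k) w = 1 ↔ FreeGroup.lift t w = 1)) :
    Tendsto (fun k => MarkedGroupSpace.mk G (s k) (hs k)) atTop
      (𝓝 (MarkedGroupSpace.mk L t ht)) := by
  rw [Metric.tendsto_nhds]
  intro ε hε
  obtain ⟨R, hR⟩ := exists_nat_gt (-Real.log ε)
  have hfin : {w : FreeGroup (Fin n) | w.norm ≤ R}.Finite :=
    (List.finite_length_le (Fin n × Bool) R).preimage FreeGroup.toWord_injective.injOn
  filter_upwards [(Filter.eventually_all_finite hfin).2 fun w _ => h w] with k hk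
  calc dist (MarkedGroupSpace.mk G (s k) (hs k)) (MarkedGroupSpace.mk L t ht)
      ≤ Real.exp (-(R : ℝ)) :=
        (MarkedGroup.distance_le_iff R ⟨G, s k, hs k⟩ ⟨L, t, ht⟩).2 hk
    _ < Real.exp (Real.log ε) := Real.exp_lt_exp.2 (by linarith)
    _ = ε := Real.exp_log hε

theorem closure_hnn_eq_top : Subgroup.closure (Set.range
    ![(HNNExtension.t : ThompsonHNN), HNNExtension.of (thompsonX 0),
      HNNExtension.of (thompsonX 1)]) = ⊤ := by
  rw [eq_top_iff]
  intro z _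
  induction z using HNNExtension.induction_on with
  | of f =>
    have hf : f ∈ Subgroup.closure {thompsonX 0, thompsonX 1} := by
      rw [closure_thompsonX_eq_top]; trivial
    have hle : Subgroup.closure {thompsonX 0, thompsonX 1} ≤ (Subgroup.closure (Set.range
        ![(HNNExtension.t : ThompsonHNN), HNNExtension.of (thompsonX 0),
          HNNExtension.of (thompsonX 1)])).comap HNNExtension.of := by
      rw [Subgroup.closure_le]
      rintro _ (rfl | rfl)
      · exact Subgroup.subset_closure ⟨1, rfl⟩
      · exact Subgroup.subset_closure ⟨2, rfl⟩
    exact hle hf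
  | t => exact Subgroup.subset_closure ⟨0, rfl⟩
  | mul x y hx hy => exact mul_mem (hx trivial) (hy trivial)
  | inv x hx => exact inv_mem (hx trivial)

theorem of_mul_t_mul_of_inv {h : thompsonF} (hh : h ∈ thompsonH1) :
    (HNNExtension.of h : ThompsonHNN) * HNNExtension.t * (HNNExtension.of h)⁻¹ =
      HNNExtension.t := by
  rw [mul_inv_eq_iff_eq_mul]
  exact (HNNExtension.t_mul_of (φ := MulEquiv.refl thompsonH1) ⟨h, hh⟩).symm

/-- Since `F` is generated by `x₀` modulo the normal subgroup `H₁`, the conjugates of the stable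
letter by elements of `F` are its conjugates by powers of `x₀`. -/
theorem exists_conj_t_eq (f : thompsonF) : ∃ k : ℤ,
    (HNNExtension.of f : ThompsonHNN) * HNNExtension.t * (HNNExtension.of f)⁻¹ =
      HNNExtension.of (thompsonX 0) ^ k * HNNExtension.t *
        (HNNExtension.of (thompsonX 0) ^ k)⁻¹ := by
  obtain ⟨k, hk⟩ := exists_zpow_mul_mem_thompsonH1 f
  refine ⟨k, ?_⟩
  obtain ⟨h, hh, rfl⟩ : ∃ h ∈ thompsonH1, f = thompsonX 0 ^ k * h := ⟨_, hk, by group⟩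
  conv_rhs => rw [← of_mul_t_mul_of_inv hh]
  simp only [map_mul, map_zpow, mul_inv_rev, mul_assoc]

instance conjWord_range_normal :
    (conjWord (HNNExtension.of (thompsonX 0)) (HNNExtension.t : ThompsonHNN)).range.Normal := by
  set K := (conjWord (HNNExtension.of (thompsonX 0)) (HNNExtension.t : ThompsonHNN)).range
  have hof : ∀ (f : thompsonF), ∀ y ∈ K,
      (HNNExtension.of f : ThompsonHNN) * y * (HNNExtension.of f)⁻¹ ∈ K := by
    rintro f _ ⟨u, rfl⟩
    induction u using FreeGroup.induction_on with
    | C1 => simp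
    | of i =>
      obtain ⟨k, hk⟩ := exists_conj_t_eq (f * thompsonX 0 ^ i)
      refine ⟨FreeGroup.of k, ?_⟩
      rw [conjWord_of, ← hk, conjWord_of]
      simp only [map_mul, map_zpow, mul_inv_rev, mul_assoc]
    | inv_of i ih =>
      rw [map_inv, ← conj_inv]
      exact inv_mem ih
    | mul u v hu hv =>
      rw [map_mul, ← conj_mul]
      exact mul_mem hu hv
  have hnorm : Subgroup.normalizer (K : Set ThompsonHNN) = ⊤ := by
    rw [eq_top_iff]
    intro z _
    induction z using HNNExtension.induction_on with
    | of f =>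
      rw [Subgroup.mem_normalizer_iff]
      refine fun y => ⟨hof f y, fun hy => ?_⟩
      have := hof f⁻¹ _ hy
      simpa [mul_assoc] using this
    | t => exact Subgroup.le_normalizer ⟨FreeGroup.of 0, by simp [conjWord_of]⟩
    | mul x y hx hy => exact mul_mem (hx trivial) (hy trivial)
    | inv x hx => exact inv_mem (hx trivial)
  exact Subgroup.normalizer_eq_top_iff.1 hnorm

/-- Every element of the HNN-extension is a word in the conjugates of the stable letter by powers of
`x₀`, followed by an element of `F`. -/
theorem exists_conjWord_mul_of (z : ThompsonHNN) : ∃ (u : FreeGroup ℤ) (f : thompsonF),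
    z = conjWord (HNNExtension.of (thompsonX 0)) HNNExtension.t u * HNNExtension.of f := by
  have htop : (conjWord (HNNExtension.of (thompsonX 0)) (HNNExtension.t : ThompsonHNN)).range ⊔
      (HNNExtension.of : thompsonF →* ThompsonHNN).range = ⊤ := by
    rw [eq_top_iff]
    intro z _
    induction z using HNNExtension.induction_on with
    | of f => exact Subgroup.mem_sup_right ⟨f, rfl⟩
    | t => exact Subgroup.mem_sup_left ⟨FreeGroup.of 0, by simp [conjWord_of]⟩
    | mul x y hx hy => exact mul_mem (hx trivial) (hy trivial)
    | inv x hx => exact inv_mem (hx trivial)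
  have hz : z ∈ (⊤ : Subgroup ThompsonHNN) := trivial
  rw [← htop, Subgroup.mem_sup_of_normal_left] at hz
  obtain ⟨_, ⟨u, rfl⟩, _, ⟨f, rfl⟩, h⟩ := hz
  exact ⟨u, f, h.symm⟩

/-- The homomorphism from the HNN-extension to the group of germs at infinity of sequences in `F`
which sends the stable letter to the sequence `g`. -/
noncomputable def germHom (g : ℕ → thompsonF)
    (hg : ∀ h ∈ thompsonH1, ∀ᶠ n in atTop, g n * h = h * g n) :
    ThompsonHNN →* Germ (atTop : Filter ℕ) thompsonF :=
  HNNExtension.lift ((Germ.coeMulHom atTop).comp (Pi.constMonoidHom ℕ thompsonF))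
    (Germ.coeMulHom atTop g) fun h => by
      simp only [MonoidHom.comp_apply, ← map_mul]
      exact Germ.coe_eq.2 (hg h h.2)

theorem germHom_lift (g : ℕ → thompsonF)
    (hg : ∀ h ∈ thompsonH1, ∀ᶠ n in atTop, g n * h = h * g n) (w : FreeGroup (Fin 3)) :
    germHom g hg (FreeGroup.lift ![HNNExtension.t, HNNExtension.of (thompsonX 0),
      HNNExtension.of (thompsonX 1)] w) =
      Germ.coeMulHom atTop (fun n => FreeGroup.lift ![g n, thompsonX 0, thompsonX 1] w) := by
  have h1 : (fun n => FreeGroup.lift ![g n, thompsonX 0, thompsonX 1] w) =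
      MonoidHom.pi (fun n => FreeGroup.lift ![g n, thompsonX 0, thompsonX 1]) w := rfl
  rw [h1, ← MonoidHom.comp_apply, ← MonoidHom.comp_apply]
  congr 1
  ext i
  have h2 : MonoidHom.pi (fun n => FreeGroup.lift ![g n, thompsonX 0, thompsonX 1])
      (FreeGroup.of i) = fun n => ![g n, thompsonX 0, thompsonX 1] i :=
    funext fun n => FreeGroup.lift_apply_of
  rw [MonoidHom.comp_apply, MonoidHom.comp_apply, FreeGroup.lift_apply_of, h2]
  fin_cases i
  · exact HNNExtension.lift_t _ _ _
  · exact HNNExtension.lift_of _ _ _ _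
  · exact HNNExtension.lift_of _ _ _ _

theorem germHom_conjWord (g : ℕ → thompsonF)
    (hg : ∀ h ∈ thompsonH1, ∀ᶠ n in atTop, g n * h = h * g n) (u : FreeGroup ℤ)
    (f : thompsonF) :
    germHom g hg (conjWord (HNNExtension.of (thompsonX 0)) HNNExtension.t u *
      HNNExtension.of f) =
      Germ.coeMulHom atTop (fun n => conjWord (thompsonX 0) (g n) u * f) := by
  have h1 : (fun n => conjWord (thompsonX 0) (g n) u * f) =
      conjWord (Pi.constMonoidHom ℕ thompsonF (thompsonX 0)) g u *
        Pi.constMonoidHom ℕ thompsonF f := by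
    funext n
    have := map_conjWord (Pi.evalMonoidHom (fun _ : ℕ => thompsonF) n)
      (Pi.constMonoidHom ℕ thompsonF (thompsonX 0)) g u
    exact congrArg (· * f) this.symm
  rw [h1, map_mul, map_mul, map_conjWord, map_conjWord]
  simp [germHom]

/-! ### `H₁` is not finitely generated -/

theorem not_fg_thompsonH1 : ¬ thompsonH1.FG := by
  rintro ⟨S, hS⟩
  have h1 : ∀ᶠ N : ℕ in atTop, ∀ f ∈ S, ∀ s : ℝ≥0, N ≤ s → f • s = s := by
    rw [Filter.eventually_all_finset]
    intro f hf
    have hf' : f ∈ thompsonH1 := hS ▸ Subgroup.subset_closure hf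
    obtain ⟨N, hN⟩ := (mem_thompsonH1_iff f).1 hf'
    filter_upwards [eventually_ge_atTop N] with M hM s hs
    exact hN s (le_trans (by exact_mod_cast hM) hs)
  obtain ⟨N, hN⟩ := h1.exists
  have hle : thompsonH1 ≤ MulAction.stabilizer thompsonF ((N + 1 : ℕ) : ℝ≥0) := by
    rw [← hS, Subgroup.closure_le]
    exact fun f hf => hN f hf _ (by simp)
  have hmem : (splitAt (N + 1))⁻¹ * splitAt N ∈ thompsonH1 := by
    rw [mem_thompsonH1_iff]
    refine ⟨N + 2, fun s hs => ?_⟩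
    obtain ⟨u, rfl⟩ := exists_add_of_le hs
    have e1 := splitAt_smul_add N (1 + u)
    have e2 := splitAt_smul_add (N + 1) u
    rw [mul_smul, inv_smul_eq_iff]
    push_cast at e1 e2 ⊢
    rw [show (N : ℝ≥0) + 2 + u = N + 1 + (1 + u) by ring, e1,
      show (N : ℝ≥0) + 1 + (1 + u) = N + 1 + 1 + u by ring, e2]
    ring
  have h2 : ((splitAt (N + 1))⁻¹ * splitAt N) • ((N + 1 : ℕ) : ℝ≥0) = (N + 1 : ℕ) := hle hmem
  have e1 := splitAt_smul_add N 0
  rw [mul_smul, inv_smul_eq_iff, splitAt_smul_of_le le_rfl] at h2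
  push_cast at h2
  rw [add_zero, add_zero, h2] at e1
  have : N + 1 = N + 2 := by exact_mod_cast e1
  omega

/-! ### Convergence -/

theorem theorem3p8 :
    (∃ (g : ℕ → thompsonF)
        (hg : ∀ n, Subgroup.closure (Set.range ![g n, thompsonX 0, thompsonX 1]) = ⊤)
        (ht : Subgroup.closure (Set.range
          ![(HNNExtension.t : CentralizedHNN thompsonF thompsonH1),
            HNNExtension.of (thompsonX 0), HNNExtension.of (thompsonX 1)]) = ⊤),
      Tendsto
        (fun n => MarkedGroupSpace.mk thompsonF ![g n, thompsonX 0, thompsonX 1] (hg n))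
        atTop
        (𝓝 (MarkedGroupSpace.mk (CentralizedHNN thompsonF thompsonH1)
          ![HNNExtension.t, HNNExtension.of (thompsonX 0), HNNExtension.of (thompsonX 1)] ht))) ∧
      ¬ thompsonH1.FG := by
  refine ⟨?_, not_fg_thompsonH1⟩
  obtain ⟨v, hv⟩ := exists_surjective_nat (FreeGroup ℤ)
  choose g hgH hgfix hgmove using exists_moving v
  have hcomm : ∀ h ∈ thompsonH1, ∀ᶠ n in atTop, g n * h = h * g n := fun h hh =>
    eventually_commute hgfix hh
  refine ⟨g, fun n => ?_, closure_hnn_eq_top, MarkedGroupSpace.tendsto_mk _ _ fun w => ?_⟩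
  · rw [eq_top_iff, ← closure_thompsonX_eq_top]
    apply Subgroup.closure_mono
    rintro _ (rfl | rfl)
    · exact ⟨1, rfl⟩
    · exact ⟨2, rfl⟩
  obtain ⟨u, f, huf⟩ := exists_conjWord_mul_of (FreeGroup.lift ![HNNExtension.t,
    HNNExtension.of (thompsonX 0), HNNExtension.of (thompsonX 1)] w)
  have hev : ∀ᶠ n in atTop, FreeGroup.lift ![g n, thompsonX 0, thompsonX 1] w =
      conjWord (thompsonX 0) (g n) u * f := by
    have := germHom_lift g hcomm w
    rw [huf, germHom_conjWord] at this
    exact (Germ.coe_eq.1 this).mono fun n h => h.symm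
  by_cases hw : FreeGroup.lift ![(HNNExtension.t : ThompsonHNN), HNNExtension.of (thompsonX 0),
      HNNExtension.of (thompsonX 1)] w = 1
  · have := germHom_lift g hcomm w
    rw [hw, map_one] at this
    have : ∀ᶠ n in atTop, (1 : ℕ → thompsonF) n =
        FreeGroup.lift ![g n, thompsonX 0, thompsonX 1] w := Germ.coe_eq.1 this
    filter_upwards [this] with n hn
    exact iff_of_true hn.symm hw
  suffices ∀ᶠ n in atTop, conjWord (thompsonX 0) (g n) u * f ≠ 1 by
    filter_upwards [hev, this] with n h1 h2
    rw [h1]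
    exact iff_of_false h2 hw
  by_cases hu : u = 1
  · have hf : f ≠ 1 := by
      rintro rfl
      exact hw (by rw [huf, hu, map_one, map_one, one_mul])
    simp [hu, hf]
  by_cases hf : f ∈ thompsonH1
  · obtain ⟨N, hN⟩ := (mem_thompsonH1_iff f).1 hf
    obtain ⟨k, rfl⟩ := hv u
    filter_upwards [eventually_ge_atTop N, eventually_ge_atTop k] with n hnN hnk h1
    obtain ⟨s, hs, hne⟩ := hgmove n k hnk hu
    apply hne
    have : (conjWord (thompsonX 0) (g n) (v k) * f) • s = s := by rw [h1, one_smul]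
    rwa [mul_smul, hN s (le_trans (by exact_mod_cast hnN) hs)] at this
  · refine Eventually.of_forall fun n h1 => hf ?_
    rw [← inv_eq_of_mul_eq_one_right h1]
    exact inv_mem (conjWord_mem _ (hgH n) u)
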